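/- Setting. Let $\mathscr C$ be a small category for which there is a bound on the lengths of sequences of composable non-identity morphisms (so composites of non-identity morphisms are never identities). Let $G$ be a finite group acting strictly on $\mathscr C$, by functors $\psi_g\colon\mathscr C\to\mathscr C$ with $\psi_1=\mathrm{Id}$, $\psi_{gh}=\psi_g\psi_h$. Let $\mathrm{Top}_*$ be the category of pointed topological spaces, and for a discrete group $K$ let $K\text{-}\mathrm{Top}_*$ be the category of pointed spaces with a continuous basepoint-preserving $K$-action and $K$-equivariant maps. A homotopy coherent diagram $F\colon\mathscr C\to\mathrm{Top}_*$ (resp. $K\text{-}\mathrm{Top}_*$) consists of spaces $F(x)$ and, for each sequence $x_0\xrightarrow{f_1}\cdots\xrightarrow{f_n}x_n$ of $n\ge1$ non-identity morphisms, a continuous map $F(f_n,\dots,f_1)\colon[0,1]^{n-1}\times F(x_0)\to F(x_n)$, basepoint-preserving (and $K$-equivariant) for each fixed $(t_1,\dots,t_{n-1})$, such that $F(f_n,\dots,f_1)(t_1,\dots,t_{n-1})$ equals $F(f_n,\dots,f_{i+1})(t_{i+1},\dots,t_{n-1})\circ F(f_i,\dots,f_1)(t_1,\dots,t_{i-1})$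 if $t_i=0$, and $F(f_n,\dots,f_{i+1}\circ f_i,\dots,f_1)(t_1,\dots,\widehat{t_i},\dots,t_{n-1})$ if $t_i=1$. Its homotopy colimit is the quotient space $$\mathrm{hocolim}\,F=\Big(\{*\}\amalg\coprod_{n\ge0}\ \coprod_{x_0\xrightarrow{f_1}\cdots\xrightarrow{f_n}x_n,\ f_i\ne\mathrm{Id}}[0,1]^n\times F(x_0)\Big)\Big/\sim,$$ where $\sim$ is the equivalence relation generated by $$(f_n,\dots,f_1;t_1,\dots,t_n;p)\sim\begin{cases}(f_n,\dots,f_{i+1};t_{i+1},\dots,t_n;F(f_i,\dots,f_1)(t_1,\dots,t_{i-1})(p)),&t_i=0,\\(f_n,\dots,f_{i+1}\circ f_i,\dots,f_1;t_1,\dots,\widehat{t_i},\dots,t_n;p),&t_i=1,\ i<n,\\(f_{n-1},\dots,f_1;t_1,\dots,t_{n-1};p),&t_n=1,\\ *,&p=*.\end{cases}$$ In the $K$-equivariant case $K$ acts on $\mathrm{hocolim}\,F$ through the coordinate $p$. An external action of $G$ on $F$ is an action $\bar\psi$ of $G$ by basepoint-preserving homeomorphisms on $\bigvee_{c}F(c)$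 that lifts the action on objects (so it is given by pointed maps $\bar\psi_g\colon F(c)\to F(\psi_g c)$) and satisfies $$\bar\psi_g\big(F(f_i,\dots,f_1)(t_1,\dots,t_{i-1})(y)\big)=F(\psi_gf_i,\dots,\psi_gf_1)(t_1,\dots,t_{i-1})(\bar\psi_g y);$$ for $F\colon\mathscr C\to K\text{-}\mathrm{Top}_*$ the actions of $K$ and $G$ are moreover required to commute. For a subgroup $H\le G$ let $\mathscr C^H\subset\mathscr C$ be the subcategory of the $H$-invariant objects and morphisms, and let $F^H$ be the homotopy coherent diagram on $\mathscr C^H$ with $F^H(u)=F(u)^H$ and with the restrictions of the maps of $F$. Claim. Suppose that $F$ has an external action by $G$. (a) If $F\colon\mathscr C\to\mathrm{Top}_*$, then $$g\,(f_m,\dots,f_1;t_1,\dots,t_m;y)=(\psi_gf_m,\dots,\psi_gf_1;t_1,\dots,t_m;\bar\psi_gy)$$ defines a continuous basepoint-preserving action of $G$ on $\mathrm{hocolim}\,F$. If $F\colon\mathscr C\to K\text{-}\mathrm{Top}_*$, then $$(k,g)\,(f_m,\dots,f_1;t_1,\dots,t_m;y)=(\psi_gf_m,\dots,\psi_gf_1;t_1,\dots,t_m;\bar\psi_g(ky))$$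 defines a continuous basepoint-preserving action of $K\times G$ on $\mathrm{hocolim}\,F$ that extends the $K$-action. (b) Suppose that the spaces $F(x)$ are Hausdorff, and let $H\le G$. Then $$(f_m,\dots,f_1;t_1,\dots,t_m;y)\mapsto(f_m,\dots,f_1;t_1,\dots,t_m;y)$$ defines a basepoint-preserving homeomorphism from $\mathrm{hocolim}(F^H)$ onto the subspace $(\mathrm{hocolim}\,F)^H$ of $\mathrm{hocolim}\,F$; it is $K$-equivariant if $F\colon\mathscr C\to K\text{-}\mathrm{Top}_*$. -/

import Mathlib

open CategoryTheory

universe u v w w'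

/-- A morphism is an identity morphism. -/
def IsIdentity {C : Type u} [Category.{v} C] {x y : C} (f : x ⟶ y) : Prop :=
  ∃ h : x = y, f = eqToHom h

/-- Sequences `x₀ ⟶ x₁ ⟶ ⋯ ⟶ xₙ` of `n` composable morphisms of `C`, with `x = x₀`, `z = xₙ`;
the outermost `cons` carries the first morphism `f₁ : x₀ ⟶ x₁`. -/
inductive Chain (C : Type u) [Category.{v} C] : ℕ → C → C → Type (max u v)
  | nil (x : C) : Chain C 0 x x
  | cons {n : ℕ} {x y z : C} (f : x ⟶ y) (c : Chain C n y z) : Chain C (n + 1) x z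

namespace Chain

variable {C : Type u} [Category.{v} C] {D : Type w} [Category.{w'} D]

/-- None of the morphisms of the sequence is an identity. -/
def Nondeg : ∀ {n : ℕ} {x z : C}, Chain C n x z → Prop
  | _, _, _, nil _ => True
  | _, _, _, cons f c => ¬ IsIdentity f ∧ c.Nondeg

/-- First the sequence `a`, then the sequence `b`. -/
def append : ∀ {m k : ℕ} {x y z : C}, Chain C m x y → Chain C k y z → Chain C (k + m) x z
  | _, _, _, _, _, nil _, b => b
  | _, _, _, _, _, cons f a, b => cons f (a.append b)

/-- Add a last morphism. -/
def snoc : ∀ {n : ℕ} {x y z : C}, Chain C n x y → (y ⟶ z) → Chain C (n + 1) x z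
  | _, _, _, _, nil _, f => cons f (nil _)
  | _, _, _, _, cons g c, f => cons g (c.snoc f)

/-- Compose two neighbouring morphisms: for the (zero-based) position `i`, the morphisms at the
positions `i` and `i + 1` are replaced by their composite. -/
def compAt : ∀ {n : ℕ} {x z : C}, Chain C (n + 2) x z → Fin (n + 1) → Chain C (n + 1) x z
  | _, _, _, cons f (cons g c), ⟨0, _⟩ => cons (f ≫ g) c
  | _ + 1, _, _, cons f c, ⟨i + 1, hi⟩ => cons f (c.compAt ⟨i, Nat.lt_of_succ_lt_succ hi⟩)

/-- The image of a sequence under a functor. -/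
def map (Φ : C ⥤ D) : ∀ {n : ℕ} {x z : C}, Chain C n x z → Chain D n (Φ.obj x) (Φ.obj z)
  | _, _, _, nil x => nil (Φ.obj x)
  | _, _, _, cons f c => cons (Φ.map f) (c.map Φ)

end Chain

/-- There is a bound on the lengths of the sequences of composable non-identity morphisms. -/
def BoundedLength (C : Type u) [Category.{v} C] : Prop :=
  ∃ N : ℕ, ∀ (n : ℕ) (x z : C) (c : Chain C n x z), c.Nondeg → n ≤ N

/-- A homotopy coherent diagram `C → Top_*` of pointed topological spaces, in the formulation for
index categories in which composites of non-identity morphisms are never identities: the data are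
indexed by the sequences of non-identity morphisms.  For a sequence `c = (fₙ₊₁, …, f₁)`, `map c` is
the map `F(fₙ₊₁, …, f₁) : [0,1]ⁿ × F(x₀) → F(xₙ₊₁)`. -/
structure HCDiagram (C : Type u) [Category.{v} C] where
  obj : C → Type w
  [top : ∀ x, TopologicalSpace (obj x)]
  base : ∀ x, obj x
  map : ∀ {n : ℕ} {x z : C} (c : Chain C (n + 1) x z), c.Nondeg →
    (Fin n → unitInterval) → obj x → obj z
  continuous_map : ∀ {n : ℕ} {x z : C} (c : Chain C (n + 1) x z) (hc : c.Nondeg),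
    Continuous fun q : (Fin n → unitInterval) × obj x => map c hc q.1 q.2
  map_base : ∀ {n : ℕ} {x z : C} (c : Chain C (n + 1) x z) (hc : c.Nondeg)
    (t : Fin n → unitInterval), map c hc t (base x) = base z
  /-- The condition at `tᵢ = 0`, where `i = m + 1`, `a = (fᵢ, …, f₁)`, `b = (fₙ, …, fᵢ₊₁)`. -/
  map_zero : ∀ {m k : ℕ} {x y z : C} (a : Chain C (m + 1) x y) (b : Chain C (k + 1) y z)
    (ha : a.Nondeg) (hb : b.Nondeg) (hab : (a.append b).Nondeg)
    (t : Fin (k + 1 + m) → unitInterval) (p : obj x), t ⟨m, by omega⟩ = 0 →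
    map (a.append b) hab t p =
      map b hb (fun j => t ⟨m + 1 + j, by omega⟩) (map a ha (fun j => t ⟨j, by omega⟩) p)
  /-- The condition at `tᵢ = 1` (the position `i` is counted from zero here). -/
  map_one : ∀ {n : ℕ} {x z : C} (c : Chain C (n + 2) x z) (i : Fin (n + 1))
    (hc : c.Nondeg) (hc' : (c.compAt i).Nondeg)
    (t : Fin (n + 1) → unitInterval) (p : obj x), t i = 1 →
    map c hc t p = map (c.compAt i) hc' (i.removeNth t) p

attribute [instance] HCDiagram.top

/-- An action of the (discrete) group `K` that turns a homotopy coherent diagram in `Top_*` into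
one in `K`-`Top_*`: all the spaces are pointed `K`-spaces, all the maps are `K`-equivariant. -/
structure KStructure (K : Type*) [Group K] {C : Type u} [Category.{v} C]
    (F : HCDiagram.{u, v, w} C) where
  act : ∀ x, MulAction K (F.obj x)
  continuous_smul : ∀ (k : K) (x : C), Continuous fun p : F.obj x => (act x).smul k p
  smul_base : ∀ (k : K) (x : C), (act x).smul k (F.base x) = F.base x
  map_smul : ∀ (k : K) {n : ℕ} {x z : C} (c : Chain C (n + 1) x z) (hc : c.Nondeg)
    (t : Fin n → unitInterval) (p : F.obj x),
    F.map c hc t ((act x).smul k p) = (act z).smul k (F.map c hc t p)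

/-- The sequences of composable non-identity morphisms, of all lengths `n ≥ 0`. -/
structure NSeq (C : Type u) [Category.{v} C] where
  len : ℕ
  src : C
  tgt : C
  chain : Chain C len src tgt
  nondeg : chain.Nondeg

section Hocolim

variable {C : Type u} [Category.{v} C] (F : HCDiagram.{u, v, w} C)

/-- The space `{*} ⨿ ∐ₙ ∐_{x₀ ⟶ ⋯ ⟶ xₙ} [0,1]ⁿ × F(x₀)`, over sequences of non-identities. -/
abbrev PreHocolim : Type (max u v w) :=
  Unit ⊕ (Σ s : NSeq C, (Fin s.len → unitInterval) × F.obj s.src)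

/-- The point `(fₙ, …, f₁; t₁, …, tₙ; p)`. -/
def PreHocolim.pt {n : ℕ} {x z : C} (c : Chain C n x z) (hc : c.Nondeg)
    (t : Fin n → unitInterval) (p : F.obj x) : PreHocolim F :=
  Sum.inr ⟨⟨n, x, z, c, hc⟩, t, p⟩

/-- The identifications that generate the equivalence relation on `PreHocolim F`. -/
inductive HoRel : PreHocolim F → PreHocolim F → Prop
  /-- `tᵢ = 0`, where `i = m + 1`, `a = (fᵢ, …, f₁)` and `b = (fₙ, …, fᵢ₊₁)`. -/
  | zero {m k : ℕ} {x y z : C} (a : Chain C (m + 1) x y) (b : Chain C k y z)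
      (ha : a.Nondeg) (hb : b.Nondeg) (hab : (a.append b).Nondeg)
      (t : Fin (k + (m + 1)) → unitInterval) (p : F.obj x) (ht : t ⟨m, by omega⟩ = 0) :
      HoRel (PreHocolim.pt F (a.append b) hab t p)
        (PreHocolim.pt F b hb (fun j => t ⟨m + 1 + j, by omega⟩)
          (F.map a ha (fun j => t ⟨j, by omega⟩) p))
  /-- `tᵢ = 1` with `i` not the last index. -/
  | one {n : ℕ} {x z : C} (c : Chain C (n + 2) x z) (i : Fin (n + 1))
      (hc : c.Nondeg) (hc' : (c.compAt i).Nondeg)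
      (t : Fin (n + 2) → unitInterval) (p : F.obj x) (ht : t i.castSucc = 1) :
      HoRel (PreHocolim.pt F c hc t p)
        (PreHocolim.pt F (c.compAt i) hc' (i.castSucc.removeNth t) p)
  /-- `tₙ = 1` for the last index `n`. -/
  | last {n : ℕ} {x y z : C} (c : Chain C n x y) (f : y ⟶ z)
      (hc : c.Nondeg) (hcf : (c.snoc f).Nondeg)
      (t : Fin (n + 1) → unitInterval) (p : F.obj x) (ht : t (Fin.last n) = 1) :
      HoRel (PreHocolim.pt F (c.snoc f) hcf t p) (PreHocolim.pt F c hc (Fin.init t) p)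
  /-- The points over a base point are identified with the base point. -/
  | base {n : ℕ} {x z : C} (c : Chain C n x z) (hc : c.Nondeg) (t : Fin n → unitInterval) :
      HoRel (PreHocolim.pt F c hc t (F.base x)) (Sum.inl ())

/-- The homotopy colimit, with the quotient topology. -/
def Hocolim : Type (max u v w) := Quot (HoRel F)

instance : TopologicalSpace (Hocolim F) :=
  inferInstanceAs (TopologicalSpace (Quot (HoRel F)))

/-- The base point of the homotopy colimit. -/
def Hocolim.base : Hocolim F := Quot.mk _ (Sum.inl ())

/-- The class of `(fₙ, …, f₁; t₁, …, tₙ; p)`. -/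
def Hocolim.mk {n : ℕ} {x z : C} (c : Chain C n x z) (hc : c.Nondeg)
    (t : Fin n → unitInterval) (p : F.obj x) : Hocolim F :=
  Quot.mk _ (PreHocolim.pt F c hc t p)

variable {F}

theorem Hocolim.ind {P : Hocolim F → Prop} (h0 : P (Hocolim.base F))
    (h : ∀ {n : ℕ} {x z : C} (c : Chain C n x z) (hc : c.Nondeg)
      (t : Fin n → unitInterval) (p : F.obj x), P (Hocolim.mk F c hc t p)) (q : Hocolim F) :
    P q := by
  induction q using Quot.ind with
  | mk q =>
    rcases q with ⟨⟩ | ⟨⟨n, x, z, c, hc⟩, t, p⟩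
    · exact h0
    · exact h c hc t p

variable {K : Type*} [Group K]

/-- The action of `k : K` on the homotopy colimit of a diagram in `K`-`Top_*`,
`k (fₙ, …, f₁; t₁, …, tₙ; p) = (fₙ, …, f₁; t₁, …, tₙ; k p)`. -/
def KStructure.hocolimMap (κ : KStructure K F) (k : K) : Hocolim F → Hocolim F :=
  Quot.lift
    (fun q => match q with
      | Sum.inl _ => Hocolim.base F
      | Sum.inr ⟨s, t, p⟩ => Hocolim.mk F s.chain s.nondeg t ((κ.act s.src).smul k p))
    (by
      intro q q' h
      induction h with
      | zero a b ha hb hab t p ht =>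
        refine (Quot.sound (HoRel.zero a b ha hb hab t _ ht)).trans ?_
        rw [κ.map_smul]
        rfl
      | one c i hc hc' t p ht => exact Quot.sound (HoRel.one c i hc hc' t _ ht)
      | last c f hc hcf t p ht => exact Quot.sound (HoRel.last c f hc hcf t _ ht)
      | base c hc t =>
        simp only [PreHocolim.pt, κ.smul_base]
        exact Quot.sound (HoRel.base c hc t))

/-- The `K`-action on the homotopy colimit of a diagram in `K`-`Top_*`. -/
@[reducible] def KStructure.hocolimAction (κ : KStructure K F) : MulAction K (Hocolim F) where
  smul := κ.hocolimMap
  one_smul q := by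
    induction q using Hocolim.ind with
    | h0 => rfl
    | h c hc t p =>
      exact congrArg (Hocolim.mk F c hc t) ((κ.act _).one_smul p)
  mul_smul k l q := by
    induction q using Hocolim.ind with
    | h0 => rfl
    | h c hc t p =>
      exact congrArg (Hocolim.mk F c hc t) ((κ.act _).mul_smul k l p)

end Hocolim

/-- An action of the group `G` on the category `C`: functors `ψ_g : C ⥤ C` with `ψ_1 = id` and
`ψ_{gh} = ψ_g ∘ ψ_h` strictly. -/
structure CategoryAction (G : Type*) [Group G] (C : Type u) [Category.{v} C] where
  functor : G → C ⥤ C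
  functor_one : functor 1 = 𝟭 C
  functor_mul : ∀ g h : G, functor (g * h) = functor h ⋙ functor g

section Action

variable {G : Type*} [Group G] {C : Type u} [Category.{v} C]

theorem IsIdentity.map {D : Type*} [Category D] (Φ : C ⥤ D) {x y : C} {f : x ⟶ y}
    (h : IsIdentity f) : IsIdentity (Φ.map f) := by
  obtain ⟨rfl, rfl⟩ := h
  exact ⟨rfl, by simp⟩

theorem IsIdentity.of_functor_eq {Φ Φ' : C ⥤ C} (e : Φ = Φ') {x y : C} {f : x ⟶ y}
    (h : IsIdentity (Φ.map f)) : IsIdentity (Φ'.map f) := by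
  subst e; exact h

theorem CategoryAction.isIdentity_of_map (ψ : CategoryAction G C) (g : G) {x y : C}
    {f : x ⟶ y} (h : IsIdentity ((ψ.functor g).map f)) : IsIdentity f := by
  have e : ψ.functor g ⋙ ψ.functor g⁻¹ = 𝟭 C := by
    rw [← ψ.functor_mul, inv_mul_cancel, ψ.functor_one]
  exact IsIdentity.of_functor_eq e (f := f) (h.map (ψ.functor g⁻¹))

theorem Chain.Nondeg.map {D : Type*} [Category D] {Φ : C ⥤ D}
    (hΦ : ∀ {x y : C} (f : x ⟶ y), IsIdentity (Φ.map f) → IsIdentity f) :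
    ∀ {n : ℕ} {x z : C} {c : Chain C n x z}, c.Nondeg → (c.map Φ).Nondeg
  | _, _, _, .nil _, _ => trivial
  | _, _, _, .cons f _, h => ⟨fun hf => h.1 (hΦ f hf), Chain.Nondeg.map hΦ h.2⟩

theorem Chain.Nondeg.act (ψ : CategoryAction G C) (g : G) {n : ℕ} {x z : C}
    {c : Chain C n x z} (hc : c.Nondeg) : (c.map (ψ.functor g)).Nondeg :=
  hc.map fun _ => ψ.isIdentity_of_map g

/-- An external action of `G` on a homotopy coherent diagram `F` over the `G`-category `C`.
A basepoint preserving action of `G` by homeomorphisms on the wedge `⋁ F(c)` that lifts the action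
on the objects is the same as a family of pointed continuous maps `ψ̄_{g,c} : F(c) → F(g c)` with
`ψ̄_1 = id` and `ψ̄_{gh} = ψ̄_g ∘ ψ̄_h`. -/
structure ExternalAction (ψ : CategoryAction G C) (F : HCDiagram.{u, v, w} C) where
  map : ∀ (g : G) (x : C), F.obj x → F.obj ((ψ.functor g).obj x)
  continuous_map : ∀ (g : G) (x : C), Continuous (map g x)
  map_base : ∀ (g : G) (x : C), map g x (F.base x) = F.base _
  map_one : ∀ (x : C) (p : F.obj x),
    (⟨_, map 1 x p⟩ : Σ c, F.obj c) = ⟨x, p⟩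
  map_mul : ∀ (g h : G) (x : C) (p : F.obj x),
    (⟨_, map (g * h) x p⟩ : Σ c, F.obj c) = ⟨_, map g _ (map h x p)⟩
  /-- The action commutes with the maps of the diagram. -/
  map_map : ∀ (g : G) {n : ℕ} {x z : C} (c : Chain C (n + 1) x z) (hc : c.Nondeg)
    (t : Fin n → unitInterval) (p : F.obj x),
    map g z (F.map c hc t p) = F.map (c.map (ψ.functor g)) (hc.act ψ g) t (map g x p)

/-- The actions of `K` and of `G` commute. -/
def ExternalAction.Commutes {ψ : CategoryAction G C} {F : HCDiagram.{u, v, w} C}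
    (E : ExternalAction ψ F) {K : Type*} [Group K] (κ : KStructure K F) : Prop :=
  ∀ (g : G) (k : K) (x : C) (p : F.obj x),
    E.map g x ((κ.act x).smul k p) = (κ.act _).smul k (E.map g x p)

/-- The objects of the fixed-point category `C^H`. -/
structure FixedCat (ψ : CategoryAction G C) (H : Subgroup G) where
  obj : C
  fixed : ∀ h ∈ H, (ψ.functor h).obj obj = obj

/-- The fixed-point category `C^H`: its morphisms are the `H`-invariant morphisms of `C`. -/
instance (ψ : CategoryAction G C) (H : Subgroup G) : Category.{v} (FixedCat ψ H) where
  Hom x y := {f : x.obj ⟶ y.obj // ∀ h ∈ H, HEq ((ψ.functor h).map f) f}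
  id x := ⟨𝟙 x.obj, fun h hh => by rw [CategoryTheory.Functor.map_id, x.fixed h hh]⟩
  comp {x y z} f g := ⟨f.1 ≫ g.1, fun h hh => by
    rw [CategoryTheory.Functor.map_comp]
    have key : ∀ {a b c a' b' c' : C} (_ : a = a') (_ : b = b') (_ : c = c')
        {p : a ⟶ b} {q : b ⟶ c} {p' : a' ⟶ b'} {q' : b' ⟶ c'}, HEq p p' → HEq q q' →
        HEq (p ≫ q) (p' ≫ q') := by
      rintro a b c _ _ _ rfl rfl rfl p q p' q' hp hq
      cases hp; cases hq; rfl
    exact key (x.fixed h hh) (y.fixed h hh) (z.fixed h hh) (f.2 h hh) (g.2 h hh)⟩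
  id_comp f := Subtype.ext (Category.id_comp f.1)
  comp_id f := Subtype.ext (Category.comp_id f.1)
  assoc f g k := Subtype.ext (Category.assoc f.1 g.1 k.1)

/-- The inclusion of the fixed-point category. -/
def FixedCat.incl (ψ : CategoryAction G C) (H : Subgroup G) : FixedCat ψ H ⥤ C where
  obj x := x.obj
  map f := f.1
  map_id _ := rfl
  map_comp _ _ := rfl

variable {ψ : CategoryAction G C} {H : Subgroup G}

theorem FixedCat.isIdentity_of_incl {x y : FixedCat ψ H} (f : x ⟶ y)
    (h : IsIdentity ((FixedCat.incl ψ H).map f)) : IsIdentity f := by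
  obtain ⟨x, hx⟩ := x
  obtain ⟨y, hy⟩ := y
  obtain ⟨h, hf⟩ := h
  change x = y at h
  subst h
  exact ⟨rfl, Subtype.ext hf⟩

theorem Chain.Nondeg.incl {n : ℕ} {x z : FixedCat ψ H} {c : Chain (FixedCat ψ H) n x z}
    (hc : c.Nondeg) : (c.map (FixedCat.incl ψ H)).Nondeg :=
  hc.map FixedCat.isIdentity_of_incl

theorem Chain.map_append {D : Type*} [Category D] (Φ : C ⥤ D) :
    ∀ {m k : ℕ} {x y z : C} (a : Chain C m x y) (b : Chain C k y z),
      (a.append b).map Φ = (a.map Φ).append (b.map Φ)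
  | _, _, _, _, _, .nil _, _ => rfl
  | _, _, _, _, _, .cons f a, b => congrArg (Chain.cons (Φ.map f)) (Chain.map_append Φ a b)

theorem Chain.map_compAt {D : Type*} [Category D] (Φ : C ⥤ D) :
    ∀ {n : ℕ} {x z : C} (c : Chain C (n + 2) x z) (i : Fin (n + 1)),
      (c.compAt i).map Φ = (c.map Φ).compAt i
  | _, _, _, .cons f (.cons g c), ⟨0, _⟩ => by simp only [Chain.compAt, Chain.map, CategoryTheory.Functor.map_comp]
  | _ + 1, _, _, .cons f (.cons g c), ⟨i + 1, hi⟩ =>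
    congrArg (Chain.cons (Φ.map f))
      (Chain.map_compAt Φ (.cons g c) ⟨i, Nat.lt_of_succ_lt_succ hi⟩)

/-- A sequence in `C^H` is invariant under `H`. -/
theorem FixedCat.chain_invariant {h : G} (hh : h ∈ H) :
    ∀ {n : ℕ} {x z : FixedCat ψ H} (c : Chain (FixedCat ψ H) n x z),
      HEq ((c.map (FixedCat.incl ψ H)).map (ψ.functor h)) (c.map (FixedCat.incl ψ H))
  | _, _, _, .nil x => by
    have key : ∀ {a b : C}, a = b → HEq (Chain.nil a) (Chain.nil b) := by
      rintro a _ rfl; rfl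
    exact key (x.fixed h hh)
  | _, _, _, .cons (x := x) (y := y) (z := z) f c => by
    have key : ∀ {n : ℕ} {x y z x' y' z' : C} (_ : x = x') (_ : y = y') (_ : z = z')
        {f : x ⟶ y} {f' : x' ⟶ y'} {c : Chain C n y z} {c' : Chain C n y' z'},
        HEq f f' → HEq c c' → HEq (Chain.cons f c) (Chain.cons f' c') := by
      rintro n x y z _ _ _ rfl rfl rfl f f' c c' hf hc
      cases hf; cases hc; rfl
    exact key (x.fixed h hh) (y.fixed h hh) (z.fixed h hh) (f.2 h hh)
      (FixedCat.chain_invariant hh c)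

theorem HCDiagram.map_congr (F : HCDiagram.{u, v, w} C) {n : ℕ} {x z x' z' : C} (hx : x = x')
    (hz : z = z') {c : Chain C (n + 1) x z} {c' : Chain C (n + 1) x' z'} (hcc : HEq c c')
    (hc : c.Nondeg) (hc' : c'.Nondeg) (t : Fin n → unitInterval) {p : F.obj x} {p' : F.obj x'}
    (hp : (⟨x, p⟩ : Σ c, F.obj c) = ⟨x', p'⟩) :
    (⟨z, F.map c hc t p⟩ : Σ c, F.obj c) = ⟨z', F.map c' hc' t p'⟩ := by
  subst hx hz
  cases hcc
  cases hp
  rfl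

variable {F : HCDiagram.{u, v, w} C}

/-- The fixed points `F(x)^H`, for an object `x` of `C^H`, with the subspace topology. -/
abbrev ExternalAction.FixedPts (E : ExternalAction ψ F) (x : FixedCat ψ H) : Type w :=
  {p : F.obj x.obj // ∀ h ∈ H, (⟨_, E.map h x.obj p⟩ : Σ c, F.obj c) = ⟨x.obj, p⟩}

/-- The restriction of a map of the diagram `F` to fixed points. -/
def ExternalAction.fixedMap (E : ExternalAction ψ F) {n : ℕ} {x z : FixedCat ψ H}
    (c : Chain (FixedCat ψ H) (n + 1) x z) (hc : c.Nondeg) (t : Fin n → unitInterval)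
    (p : E.FixedPts x) : E.FixedPts z :=
  ⟨F.map (c.map (FixedCat.incl ψ H)) hc.incl t p.1, fun h hh => by
    refine (congrArg (fun q => (⟨_, q⟩ : Σ c, F.obj c)) (E.map_map h _ hc.incl t p.1)).trans ?_
    exact F.map_congr (x.fixed h hh) (z.fixed h hh) (FixedCat.chain_invariant hh c) _ _ t
      (p.2 h hh)⟩

theorem ExternalAction.continuous_fixedMap (E : ExternalAction ψ F) {n : ℕ} {x z : FixedCat ψ H}
    (c : Chain (FixedCat ψ H) (n + 1) x z) (hc : c.Nondeg) :
    Continuous fun q : (Fin n → unitInterval) × E.FixedPts x => E.fixedMap c hc q.1 q.2 := by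
  have h : Continuous fun q : (Fin n → unitInterval) × E.FixedPts x =>
      ((q.1, q.2.1) : (Fin n → unitInterval) × F.obj x.obj) :=
    continuous_fst.prodMk (continuous_subtype_val.comp continuous_snd)
  exact Continuous.subtype_mk ((F.continuous_map _ hc.incl).comp h) _

/-- The restricted diagram `F^H : C^H → Top_*`, with `F^H(x) = F(x)^H` and with the restrictions
of the maps of `F`. -/
def ExternalAction.fixedDiagram (E : ExternalAction ψ F) (H : Subgroup G) :
    HCDiagram.{u, v, w} (FixedCat ψ H) where
  obj x := E.FixedPts x
  top x := inferInstanceAs (TopologicalSpace (E.FixedPts x))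
  base x := ⟨F.base x.obj, fun h hh => by
    rw [E.map_base]
    exact congrArg (fun c => (⟨c, F.base c⟩ : Σ c, F.obj c)) (x.fixed h hh)⟩
  map c hc t p := E.fixedMap c hc t p
  continuous_map c hc := E.continuous_fixedMap c hc
  map_base c hc t := Subtype.ext (F.map_base _ hc.incl t)
  map_zero {m k x y z} a b ha hb hab t p ht := Subtype.ext (by
    have h := F.map_zero _ _ ha.incl hb.incl
      (Chain.map_append (FixedCat.incl ψ H) a b ▸ hab.incl) t p.1 ht
    simp only [ExternalAction.fixedMap, Chain.map_append]
    exact h)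
  map_one c i hc hc' t p ht := Subtype.ext (by
    have h := F.map_one _ i hc.incl (Chain.map_compAt (FixedCat.incl ψ H) c i ▸ hc'.incl) t p.1 ht
    simp only [ExternalAction.fixedMap, Chain.map_compAt]
    exact h)

/-- The `K`-action on the restricted diagram, so that it is a diagram `F^H : C^H → K`-`Top_*`. -/
def KStructure.fixed {K : Type*} [Group K] (κ : KStructure K F) (E : ExternalAction ψ F)
    (hκ : E.Commutes κ) (H : Subgroup G) : KStructure K (E.fixedDiagram H) where
  act x :=
    { smul := fun k p => ⟨(κ.act x.obj).smul k p.1, fun h hh => by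
        rw [hκ]
        exact congrArg (fun q : Σ c, F.obj c => (⟨q.1, (κ.act q.1).smul k q.2⟩ : Σ c, F.obj c))
          (p.2 h hh)⟩
      one_smul := fun p => Subtype.ext ((κ.act x.obj).one_smul p.1)
      mul_smul := fun k l p => Subtype.ext ((κ.act x.obj).mul_smul k l p.1) }
  continuous_smul k x :=
    ((κ.continuous_smul k x.obj).comp continuous_subtype_val).subtype_mk _
  smul_base k x := Subtype.ext (κ.smul_base k x.obj)
  map_smul k _ _ _ c hc t p := Subtype.ext (κ.map_smul k _ hc.incl t p.1)

end Action

/-!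
The point is that the points of `hocolim F` have unique reduced representatives.  A representative
`(fₙ, …, f₁; t₁, …, tₙ; p)` is called reduced if all `tᵢ` lie in the open interval `(0,1)` and `p`
is not the base point.  A representative that is not reduced represents the base point or can be
shortened by one of the identifications, so reduced representatives exist
(`Hocolim.eq_base_or_exists_isReduced`).  They are unique (`Hocolim.IsReduced.mk_inj`), because there
is an invariant of the identifications that determines them, `Hocolim.normalForm`: push `p` along
the part of the sequence up to the *last* parameter `0`, then remove all the parameters `1` from
what is left.  Composites of non-identity morphisms are again non-identity morphisms, which is what
the bound on the lengths is needed for.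

A morphism of diagrams over a functor that preserves non-identities induces a map of homotopy
colimits (`Hocolim.map`).  This gives the action of `G`, and the map from `hocolim F^H` to
`hocolim F`.  The latter takes reduced representatives to reduced representatives, so it is
injective; and a point is fixed by `H` if and only if its reduced representative is, that is, if
the sequence lies in `C^H` and `p` is a fixed point, so the image is the fixed point set
(`Hocolim.range_map_inclHom`).

If the spaces `F(x)` are Hausdorff, their fixed point sets are closed, and the map is closed
(`Hocolim.isClosed_preimage_mk_image`): the preimage of the image of a closed set in the cell
`[0,1]ⁿ × F(x₀)` of a sequence is the union of its intersections with the faces `tᵢ = 0` and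
`tᵢ = 1`, with the points over the base point, and of a closed set of fixed points.  The
intersections with the faces are preimages of the corresponding sets of shorter sequences.
-/

/-! ### Sequences of non-identity morphisms -/

section Identities

variable {C : Type u} [Category.{v} C]

theorem IsIdentity.of_comp_right {x y z : C} {f : x ⟶ y} {g : y ⟶ z}
    (h : IsIdentity (f ≫ g)) (hg : IsIdentity g) : IsIdentity f := by
  obtain ⟨rfl, rfl⟩ := hg
  simpa using h

/-- The sequence `f, g, f, g, …` of length `2 n`. -/
def Chain.alternate {x y : C} (f : x ⟶ y) (g : y ⟶ x) : (n : ℕ) → Chain C (2 * n) x x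
  | 0 => .nil x
  | n + 1 => .cons f (.cons g (Chain.alternate f g n))

theorem Chain.nondeg_alternate {x y : C} {f : x ⟶ y} {g : y ⟶ x} (hf : ¬ IsIdentity f)
    (hg : ¬ IsIdentity g) : ∀ n, (Chain.alternate f g n).Nondeg
  | 0 => trivial
  | n + 1 => ⟨hf, hg, Chain.nondeg_alternate hf hg n⟩

/-- If `f ≫ g` were an identity, the sequences `f, g, f, g, …` would have unbounded length. -/
theorem BoundedLength.not_isIdentity_comp (hC : BoundedLength C) {x y z : C} {f : x ⟶ y}
    {g : y ⟶ z} (hf : ¬ IsIdentity f) : ¬ IsIdentity (f ≫ g) := by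
  intro h
  by_cases hg : IsIdentity g
  · exact hf (h.of_comp_right hg)
  obtain ⟨rfl, -⟩ := h
  obtain ⟨N, hN⟩ := hC
  have := hN _ _ _ _ (Chain.nondeg_alternate hf hg (N + 1))
  omega

theorem Chain.compAt_cons_cons_zero {n : ℕ} {x y z x' : C} (f : x ⟶ y) (g : y ⟶ z)
    (c : Chain C n z x') : (Chain.cons f (.cons g c)).compAt 0 = .cons (f ≫ g) c := by
  rw [show (0 : Fin (n + 1)) = ⟨0, n.succ_pos⟩ from rfl, Chain.compAt]

theorem Chain.compAt_cons_succ {n : ℕ} {x y z : C} (f : x ⟶ y) (c : Chain C (n + 2) y z)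
    (i : Fin (n + 1)) : (Chain.cons f c).compAt i.succ = .cons f (c.compAt i) := by
  cases c
  rfl

theorem Chain.Nondeg.compAt (hC : BoundedLength C) :
    ∀ {n : ℕ} {x z : C} {c : Chain C (n + 2) x z}, c.Nondeg → ∀ i, (c.compAt i).Nondeg
  | _, _, _, .cons _ (.cons _ _), h, ⟨0, _⟩ => by
    simp only [Chain.compAt]
    exact ⟨hC.not_isIdentity_comp h.1, h.2.2⟩
  | _ + 1, _, _, .cons _ (.cons _ _), h, ⟨i + 1, hi⟩ =>
    ⟨h.1, Chain.Nondeg.compAt hC h.2 ⟨i, Nat.lt_of_succ_lt_succ hi⟩⟩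

theorem Chain.nondeg_append : ∀ {m k : ℕ} {x y z : C} {a : Chain C m x y} {b : Chain C k y z},
    (a.append b).Nondeg ↔ a.Nondeg ∧ b.Nondeg
  | _, _, _, _, _, .nil _, _ => (iff_of_eq (true_and _)).symm
  | _, _, _, _, _, .cons _ a, b => by
    simp only [Chain.append, Chain.Nondeg, Chain.nondeg_append (a := a), and_assoc]

theorem Chain.nondeg_snoc : ∀ {n : ℕ} {x y z : C} {c : Chain C n x y} {f : y ⟶ z},
    (c.snoc f).Nondeg ↔ c.Nondeg ∧ ¬ IsIdentity f
  | _, _, _, _, .nil _, _ => by simp [Chain.snoc, Chain.Nondeg]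
  | _, _, _, _, .cons _ c, f => by
    simp only [Chain.snoc, Chain.Nondeg, Chain.nondeg_snoc (c := c), and_assoc]

variable {D : Type w} [Category.{w'} D]

theorem Chain.map_snoc (Φ : C ⥤ D) : ∀ {n : ℕ} {x y z : C} (c : Chain C n x y) (f : y ⟶ z),
    (c.snoc f).map Φ = (c.map Φ).snoc (Φ.map f)
  | _, _, _, _, .nil _, _ => rfl
  | _, _, _, _, .cons g c, f => congrArg (Chain.cons (Φ.map g)) (Chain.map_snoc Φ c f)

theorem Chain.map_id : ∀ {n : ℕ} {x z : C} (c : Chain C n x z), c.map (𝟭 C) = c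
  | _, _, _, .nil _ => rfl
  | _, _, _, .cons f c => congrArg (Chain.cons f) (Chain.map_id c)

theorem Chain.map_comp {D' : Type*} [Category D'] (Φ : C ⥤ D) (Ψ : D ⥤ D') :
    ∀ {n : ℕ} {x z : C} (c : Chain C n x z), c.map (Φ ⋙ Ψ) = (c.map Φ).map Ψ
  | _, _, _, .nil _ => rfl
  | _, _, _, .cons f c => congrArg (Chain.cons (Ψ.map (Φ.map f))) (Chain.map_comp Φ Ψ c)

/-- A sequence can be cut behind each of its morphisms. -/
theorem Chain.exists_eq_append {n : ℕ} {x z : C} (c : Chain C n x z) (i : Fin n) :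
    ∃ (m k : ℕ) (y : C) (a : Chain C (m + 1) x y) (b : Chain C k y z),
      ∃ _ : n = k + (m + 1), HEq c (a.append b) ∧ i.val = m := by
  induction c with
  | nil => exact i.elim0
  | @cons n x y z f c ih =>
    induction i using Fin.cases with
    | zero => exact ⟨0, n, y, .cons f (.nil y), c, rfl, HEq.rfl, rfl⟩
    | succ i =>
      obtain ⟨m, k, y', a, b, rfl, h, hi⟩ := ih i
      cases h
      exact ⟨m + 1, k, y', .cons f a, b, rfl, HEq.rfl, by simp [hi]⟩

theorem Chain.exists_eq_snoc : ∀ {n : ℕ} {x z : C} (c : Chain C (n + 1) x z),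
    ∃ (y : C) (a : Chain C n x y) (f : y ⟶ z), c = a.snoc f
  | 0, _, _, .cons f (.nil _) => ⟨_, .nil _, f, rfl⟩
  | n + 1, _, _, .cons f c => by
    obtain ⟨y, a, g, rfl⟩ := Chain.exists_eq_snoc c
    exact ⟨y, .cons f a, g, rfl⟩

end Identities

/-! ### Labelled paths and the removal of the labels `0` and `1` -/

section LabelledPaths

variable {C : Type u} [Category.{v} C]

/-- Sequences of composable morphisms that start at `x`, each morphism with a parameter in
`[0,1]`. -/
inductive LabelledPath (C : Type u) [Category.{v} C] : C → Type (max u v)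
  | nil (x : C) : LabelledPath C x
  | cons {x y : C} (f : x ⟶ y) (t : unitInterval) (d : LabelledPath C y) : LabelledPath C x

/-- The sequence `c`, labelled by `t`, followed by `d`. -/
def Chain.labelAppend : ∀ {n : ℕ} {x y : C}, Chain C n x y → (Fin n → unitInterval) →
    LabelledPath C y → LabelledPath C x
  | _, _, _, .nil _, _, d => d
  | _, _, _, .cons f c, t, d => .cons f (t 0) (c.labelAppend (fun j => t j.succ) d)

/-- The sequence `c`, labelled by `t`. -/
def Chain.label {n : ℕ} {x z : C} (c : Chain C n x z) (t : Fin n → unitInterval) :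
    LabelledPath C x :=
  c.labelAppend t (.nil z)

namespace LabelledPath

/-- Compose `f` with the first morphism of a path; the empty path remains empty. -/
def precomp {x y : C} (f : x ⟶ y) : LabelledPath C y → LabelledPath C x
  | nil _ => nil x
  | cons g t d => cons (f ≫ g) t d

theorem precomp_comp {x y z : C} (f : x ⟶ y) (g : y ⟶ z) :
    ∀ d, precomp (f ≫ g) d = precomp f (precomp g d)
  | nil _ => rfl
  | cons h t d => by simp [precomp]

open Classical in
/-- Remove all the labels `1`: a morphism with this label is composed with the one that follows
it, and is dropped if it is the last one. -/
noncomputable def contract : ∀ {x : C}, LabelledPath C x → LabelledPath C x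
  | _, nil x => nil x
  | _, cons f t d => if t = 1 then precomp f d.contract else cons f t d.contract

open Classical in
/-- Cut a path behind its last label `0`, if there is one. -/
noncomputable def splitZero : ∀ {x : C}, LabelledPath C x →
    Option (Σ (n : ℕ) (y : C), Chain C n x y × (Fin n → unitInterval) × LabelledPath C y)
  | _, nil _ => none
  | _, cons (y := y) f t d =>
    match splitZero d with
    | some ⟨n, z, a, s, b⟩ => some ⟨n + 1, z, .cons f a, Fin.cons t s, b⟩
    | none => if t = 0 then some ⟨1, y, .cons f (.nil y), fun _ => t, d⟩ else none

/-- None of the morphisms of the path is an identity. -/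
def Nondeg : ∀ {x : C}, LabelledPath C x → Prop
  | _, nil _ => True
  | _, cons f _ d => ¬ IsIdentity f ∧ d.Nondeg

/-- `d'` is obtained from `d` by the removal of one label `1`. -/
inductive OneStep : ∀ {x : C}, LabelledPath C x → LabelledPath C x → Prop
  | comp {x y z : C} (f : x ⟶ y) (g : y ⟶ z) (s : unitInterval) (d : LabelledPath C z) :
      OneStep (cons f 1 (cons g s d)) (cons (f ≫ g) s d)
  | drop {x y : C} (f : x ⟶ y) : OneStep (cons f 1 (nil y)) (nil x)
  | cons {x y : C} (f : x ⟶ y) (t : unitInterval) {d d' : LabelledPath C y} :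
      OneStep d d' → OneStep (cons f t d) (cons f t d')

/-- `contract` does not depend on the order in which the labels `1` are removed. -/
theorem OneStep.contract_eq {x : C} {d d' : LabelledPath C x} (h : OneStep d d') :
    d.contract = d'.contract := by
  induction h with
  | comp f g s d =>
    by_cases hs : s = 1
    · simp [contract, hs, precomp_comp]
    · simp [contract, hs, precomp]
  | drop f => simp [contract, precomp]
  | cons f t _ ih => simp only [contract, ih]

/-- The removal of a label `1` takes place in the path behind the last label `0`, or in the part in
front of it; there it is never the last label, which is `0`, so that it composes two morphisms.
If no label is `0`, none is after the removal. -/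
theorem OneStep.splitZero_cases {x : C} {d d' : LabelledPath C x} (h : OneStep d d') :
    (d.splitZero = none ∧ d'.splitZero = none) ∨
    (∃ n y a s b b', d.splitZero = some ⟨n, y, a, s, b⟩ ∧ d'.splitZero = some ⟨n, y, a, s, b'⟩ ∧
      OneStep b b') ∨
    (∃ (n : ℕ) (y : C) (a : Chain C (n + 2) x y) (s : Fin (n + 2) → unitInterval)
      (b : LabelledPath C y) (i : Fin (n + 1)), s i.castSucc = 1 ∧
      d.splitZero = some ⟨n + 2, y, a, s, b⟩ ∧
      d'.splitZero = some ⟨n + 1, y, a.compAt i, i.castSucc.removeNth s, b⟩) := by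
  induction h with
  | @comp x y z f g s d =>
    rcases hd : d.splitZero with - | ⟨n, y', a, r, b⟩
    · by_cases hs : s = 0
      · refine Or.inr (Or.inr ⟨0, z, .cons f (.cons g (.nil z)), Fin.cons 1 (fun _ => s), d, 0,
          rfl, ?_, ?_⟩)
        · simp [splitZero, hd, hs]
        · simp only [splitZero, hd, hs, if_true, Chain.compAt_cons_cons_zero]
          congr
      · left; simp [splitZero, hd, hs]
    · refine Or.inr (Or.inr ⟨n, y', .cons f (.cons g a), Fin.cons 1 (Fin.cons s r), b, 0,
        rfl, ?_, ?_⟩)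
      · simp [splitZero, hd]
      · simp only [splitZero, hd, Chain.compAt_cons_cons_zero]
        congr
  | drop f => left; simp [splitZero]
  | @cons x y f t d d' h ih =>
    rcases ih with ⟨h1, h2⟩ | ⟨n, y', a, s, b, b', h1, h2, h3⟩ | ⟨n, y', a, s, b, i, hi, h1, h2⟩
    · by_cases ht : t = 0
      · exact Or.inr (Or.inl ⟨1, y, .cons f (.nil y), fun _ => t, d, d', by simp [splitZero, h1, ht],
          by simp [splitZero, h2, ht], h⟩)
      · left; simp [splitZero, h1, h2, ht]
    · exact Or.inr (Or.inl ⟨n + 1, y', .cons f a, Fin.cons t s, b, b', by simp [splitZero, h1],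
        by simp [splitZero, h2], h3⟩)
    · refine Or.inr (Or.inr ⟨n + 1, y', .cons f a, Fin.cons t s, b, i.succ, ?_, ?_, ?_⟩)
      · rw [Fin.castSucc_succ, Fin.cons_succ, hi]
      · simp [splitZero, h1]
      · simp only [splitZero, h2]
        have : (i.succ.castSucc.removeNth (Fin.cons t s : Fin (n + 3) → unitInterval)) =
            Fin.cons t (i.castSucc.removeNth s) := by
          funext j
          induction j using Fin.cases with
          | zero => simp [Fin.removeNth]
          | succ j => simp [Fin.removeNth]
        rw [this, Chain.compAt_cons_succ]

theorem Nondeg.of_splitZero {x : C} {d : LabelledPath C x} (hd : d.Nondeg) {n y a s b}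
    (h : d.splitZero = some ⟨n, y, a, s, b⟩) : a.Nondeg := by
  induction d generalizing n y with
  | nil => simp [splitZero] at h
  | @cons x y' f t d ih =>
    rcases hs : d.splitZero with - | ⟨n', y'', a', s', b'⟩
    · by_cases ht : t = 0
      · simp only [splitZero, hs, ht, if_true, Option.some.injEq] at h
        cases h
        exact ⟨hd.1, trivial⟩
      · simp [splitZero, hs, ht] at h
    · simp only [splitZero, hs, Option.some.injEq] at h
      cases h
      exact ⟨hd.1, ih hd.2 hs⟩

theorem ne_zero_of_splitZero {x : C} {d : LabelledPath C x} {n y a s b}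
    (h : d.splitZero = some ⟨n, y, a, s, b⟩) : n ≠ 0 := by
  rintro rfl
  cases d with
  | nil => simp [splitZero] at h
  | cons f t d =>
    rcases hs : d.splitZero with - | ⟨n', y'', a', s', b'⟩
    · by_cases ht : t = 0
      · simp only [splitZero, hs, ht, if_true, Option.some.injEq] at h
        cases h
      · simp [splitZero, hs, ht] at h
    · simp only [splitZero, hs, Option.some.injEq] at h
      cases h

theorem cons_inj {x y x' y' : C} {f : x ⟶ y} {f' : x' ⟶ y'} {t t' : unitInterval}
    {d : LabelledPath C y} {d' : LabelledPath C y'}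
    (h : (⟨x, cons f t d⟩ : Σ x, LabelledPath C x) = ⟨x', cons f' t' d'⟩) :
    x = x' ∧ y = y' ∧ HEq f f' ∧ t = t' ∧
      (⟨y, d⟩ : Σ x, LabelledPath C x) = ⟨y', d'⟩ := by
  cases h
  exact ⟨rfl, rfl, HEq.rfl, rfl, rfl⟩

end LabelledPath

namespace Chain

open LabelledPath

theorem nondeg_label : ∀ {n : ℕ} {x z : C} {c : Chain C n x z}, c.Nondeg →
    ∀ t, (c.label t).Nondeg
  | _, _, _, .nil _, _, _ => trivial
  | _, _, _, .cons _ _, h, _ => ⟨h.1, nondeg_label h.2 _⟩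

theorem label_append : ∀ {m k : ℕ} {x y z : C} (a : Chain C m x y) (b : Chain C k y z)
    (t : Fin (k + m) → unitInterval),
    (a.append b).label t = a.labelAppend (fun j => t ⟨j, by omega⟩)
      (b.label fun j => t ⟨m + j, by omega⟩)
  | _, _, _, _, _, .nil _, b, t => by
    simp only [Chain.append, Chain.labelAppend]
    congr 1
    funext j
    congr 1
    ext
    simp
  | _, _, _, _, _, .cons f a, b, t => by
    have := label_append a b (fun j => t j.succ)
    simp only [Chain.append, Chain.labelAppend, Chain.label] at this ⊢
    refine congrArg (LabelledPath.cons f (t 0)) (this.trans ?_)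
    congr 2
    funext j
    congr 1
    ext
    simp
    omega

theorem oneStep_label_compAt : ∀ {n : ℕ} {x z : C} (c : Chain C (n + 2) x z) (i : Fin (n + 1))
    (t : Fin (n + 2) → unitInterval), t i.castSucc = 1 →
    OneStep (c.label t) ((c.compAt i).label (i.castSucc.removeNth t))
  | _, _, _, .cons f (.cons g c), ⟨0, _⟩, t, h => by
    have h0 : t 0 = 1 := h
    simp only [Chain.compAt, Chain.label, Chain.labelAppend, h0]
    exact OneStep.comp f g _ _
  | n + 1, _, _, .cons f c, ⟨i + 1, hi⟩, t, h => by
    have := oneStep_label_compAt c ⟨i, Nat.lt_of_succ_lt_succ hi⟩ (fun j => t j.succ) h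
    have h2 := OneStep.cons f (t 0) this
    cases c with
    | cons g c =>
    simp only [Chain.compAt, Chain.label, Chain.labelAppend] at h2 ⊢
    have h0 : (Fin.castSucc ⟨i + 1, hi⟩).removeNth t 0 = t 0 := rfl
    have h1 : (fun j => (Fin.castSucc ⟨i + 1, hi⟩).removeNth t j.succ) =
        (Fin.castSucc ⟨i, Nat.lt_of_succ_lt_succ hi⟩).removeNth fun j => t j.succ := by
      funext j
      have := Fin.succ_succAbove_succ (Fin.castSucc ⟨i, Nat.lt_of_succ_lt_succ hi⟩) j
      exact congrArg t this
    rw [h0, h1]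
    exact h2

theorem oneStep_label_snoc : ∀ {n : ℕ} {x y z : C} (c : Chain C n x y) (f : y ⟶ z)
    (t : Fin (n + 1) → unitInterval), t (Fin.last n) = 1 →
    OneStep ((c.snoc f).label t) (c.label (Fin.init t))
  | _, _, _, _, .nil _, f, t, h => by
    have h0 : t 0 = 1 := h
    simp only [Chain.snoc, Chain.label, Chain.labelAppend, h0]
    exact OneStep.drop f
  | _, _, _, _, .cons g c, f, t, h =>
    OneStep.cons g (t 0) (oneStep_label_snoc c f (fun j => t j.succ) h)

/-- If `b` has no label `0`, a path that ends with the label `0` is cut off from `b`. -/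
theorem splitZero_labelAppend_of_none : ∀ {m : ℕ} {x y : C} (a : Chain C (m + 1) x y)
    (t : Fin (m + 1) → unitInterval) (b : LabelledPath C y), t (Fin.last m) = 0 →
    b.splitZero = none → (a.labelAppend t b).splitZero = some ⟨m + 1, y, a, t, b⟩
  | 0, _, _, .cons f (.nil _), t, b, h, hb => by
    have h0 : t 0 = 0 := h
    have h1 : t = fun _ => 0 := by funext j; rw [Fin.fin_one_eq_zero j, h0]
    simp only [Chain.labelAppend, splitZero, hb, if_true, h1]
  | m + 1, _, _, .cons f a, t, b, h, hb => by
    have := splitZero_labelAppend_of_none a (fun j => t j.succ) b h hb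
    simp only [Chain.labelAppend, splitZero, this]
    rw [show (Fin.cons (t 0) fun j => t j.succ : Fin (m + 2) → unitInterval) = t from
      Fin.cons_self_tail t]

/-- The concatenation of two families of parameters, in the order of `Chain.append`. -/
def glue {n k : ℕ} (t : Fin n → unitInterval) (s : Fin k → unitInterval) :
    Fin (k + n) → unitInterval :=
  fun j => if h : j.val < n then t ⟨j, h⟩ else s ⟨j - n, by omega⟩

theorem splitZero_labelAppend_of_some {k : ℕ} {y z : C} {b : LabelledPath C y} {a' : Chain C k y z}
    {s : Fin k → unitInterval} {b' : LabelledPath C z}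
    (hb : b.splitZero = some ⟨k, z, a', s, b'⟩) :
    ∀ {n : ℕ} {x : C} (a : Chain C n x y) (t : Fin n → unitInterval),
    (a.labelAppend t b).splitZero = some ⟨k + n, z, a.append a', glue t s, b'⟩
  | _, _, .nil _, t => by
    rw [Chain.labelAppend, hb]
    rfl
  | n + 1, _, .cons f a, t => by
    have := splitZero_labelAppend_of_some hb a (fun j => t j.succ)
    simp only [Chain.labelAppend, splitZero, this, Chain.append]
    have h : (Fin.cons (t 0) (glue (fun j => t j.succ) s) : Fin (k + n + 1) → unitInterval) =
        glue (n := n + 1) t s := by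
      funext j
      induction j using Fin.cases with
      | zero => simp [glue]
      | succ j =>
        simp only [glue, Fin.cons_succ, Fin.val_succ, Nat.add_lt_add_iff_right,
          Nat.add_sub_add_right]
        rfl
    rw [h]
    rfl

theorem splitZero_label_of_forall_ne : ∀ {n : ℕ} {x z : C} (c : Chain C n x z)
    (t : Fin n → unitInterval), (∀ i, t i ≠ 0) → (c.label t).splitZero = none
  | _, _, _, .nil _, _, _ => rfl
  | _, _, _, .cons f c, t, h => by
    have := splitZero_label_of_forall_ne c (fun j => t j.succ) fun i => h i.succ
    simp only [Chain.label, Chain.labelAppend, splitZero] at this ⊢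
    simp [this, h 0]

theorem contract_label_of_forall_ne : ∀ {n : ℕ} {x z : C} (c : Chain C n x z)
    (t : Fin n → unitInterval), (∀ i, t i ≠ 1) → (c.label t).contract = c.label t
  | _, _, _, .nil _, _, _ => rfl
  | _, _, _, .cons f c, t, h => by
    have := contract_label_of_forall_ne c (fun j => t j.succ) fun i => h i.succ
    simp only [Chain.label, Chain.labelAppend, contract] at this ⊢
    simp [this, h 0]

theorem label_injective {n : ℕ} {x z : C} (c : Chain C n x z) (t : Fin n → unitInterval) :
    ∀ {n' : ℕ} {x' z' : C} (c' : Chain C n' x' z') (t' : Fin n' → unitInterval),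
    (⟨x, c.label t⟩ : Σ x, LabelledPath C x) = ⟨x', c'.label t'⟩ →
    n = n' ∧ x = x' ∧ z = z' ∧ HEq c c' ∧ HEq t t' := by
  induction c with
  | nil x =>
    intro n' x' z' c' t' h
    cases c' with
    | nil x' =>
      cases h
      exact ⟨rfl, rfl, rfl, HEq.rfl, heq_of_eq (Subsingleton.elim _ _)⟩
    | cons f c' => 
      exfalso
      simp only [Chain.label, Chain.labelAppend] at h
      cases h
  | cons f c ih =>
    intro n' x' z' c' t' h
    cases c' with
    | nil x' =>
      exfalso
      simp only [Chain.label, Chain.labelAppend] at h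
      cases h
    | cons f' c' =>
      obtain ⟨rfl, rfl, hf, h0, h⟩ := cons_inj h
      obtain ⟨rfl, -, rfl, hc, ht⟩ := ih _ _ _ h
      cases hf
      cases hc
      refine ⟨rfl, rfl, rfl, HEq.rfl, heq_of_eq ?_⟩
      funext j
      induction j using Fin.cases with
      | zero => exact h0
      | succ j => exact congrFun (eq_of_heq ht) j

end Chain

end LabelledPaths

/-! ### Normal forms of the points of a homotopy colimit -/

section NormalForm

variable {C : Type u} [Category.{v} C] (F : HCDiagram.{u, v, w} C)

namespace HCDiagram

open Classical in
/-- The map `F(fₙ, …, f₁)(t₁, …, tₙ₋₁)`, extended by the identity to the empty sequence and by the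
constant map to sequences that contain identities.  The last parameter `tₙ` is ignored. -/
noncomputable def eval : ∀ {n : ℕ} {x z : C}, Chain C n x z → (Fin n → unitInterval) →
    F.obj x → F.obj z
  | _, _, _, .nil _, _, p => p
  | _, _, z, .cons f c, t, p =>
    if h : (Chain.cons f c).Nondeg then F.map (.cons f c) h (Fin.init t) p else F.base z

variable {F}

theorem eval_of_nondeg {n : ℕ} {x z : C} {c : Chain C (n + 1) x z} (hc : c.Nondeg)
    (t : Fin (n + 1) → unitInterval) (p : F.obj x) :
    F.eval c t p = F.map c hc (Fin.init t) p := by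
  cases c
  simp only [eval, hc, dif_pos]

theorem eval_of_not_nondeg {n : ℕ} {x z : C} {c : Chain C (n + 1) x z} (hc : ¬ c.Nondeg)
    (t : Fin (n + 1) → unitInterval) (p : F.obj x) : F.eval c t p = F.base z := by
  cases c
  simp only [eval, hc, dif_neg, not_false_eq_true]

theorem eval_base {n : ℕ} {x z : C} (c : Chain C n x z) (t : Fin n → unitInterval) :
    F.eval c t (F.base x) = F.base z := by
  cases n with
  | zero => cases c; rfl
  | succ n =>
    by_cases hc : c.Nondeg
    · rw [eval_of_nondeg hc, F.map_base]
    · exact eval_of_not_nondeg hc _ _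

/-- The condition of a coherent diagram at `tᵢ = 0`.  No assumption on identities is needed: if
`a` or `b` contains one, both sides are the base point. -/
theorem eval_append {m k : ℕ} {x y z : C} (a : Chain C (m + 1) x y) (b : Chain C (k + 1) y z)
    (t : Fin (m + 1) → unitInterval) (s : Fin (k + 1) → unitInterval) (ht : t (Fin.last m) = 0)
    (p : F.obj x) : F.eval (a.append b) (Chain.glue t s) p = F.eval b s (F.eval a t p) := by
  by_cases ha : a.Nondeg
  · by_cases hb : b.Nondeg
    · have hab : (a.append b).Nondeg := Chain.nondeg_append.2 ⟨ha, hb⟩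
      have e : F.eval (a.append b) (Chain.glue t s) p =
          F.map (a.append b) hab (fun j : Fin (k + 1 + m) => Chain.glue t s j.castSucc) p :=
        eval_of_nondeg (n := k + 1 + m) hab _ _
      rw [e, F.map_zero a b ha hb hab, eval_of_nondeg ha, eval_of_nondeg hb]
      · congr 1
        · funext j
          simp only [Chain.glue, Fin.val_castSucc, Fin.init]
          rw [dif_neg (by omega)]
          congr 1
          ext
          simp
        · congr 1
          funext j
          simp only [Chain.glue, Fin.val_castSucc, Fin.init]
          rw [dif_pos (by omega)]
          rfl
      · simp only [Chain.glue, Fin.val_castSucc]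
        rw [dif_pos (by omega)]
        exact ht
    · rw [eval_of_not_nondeg hb]
      exact eval_of_not_nondeg (n := k + 1 + m) (fun h => hb (Chain.nondeg_append (a := a).1 h).2) _ _
  · rw [eval_of_not_nondeg ha, eval_base]
    exact eval_of_not_nondeg (n := k + 1 + m) (fun h => ha (Chain.nondeg_append (b := b).1 h).1) _ _

theorem eval_compAt (hC : BoundedLength C) {n : ℕ} {x z : C} {c : Chain C (n + 2) x z}
    (hc : c.Nondeg) (i : Fin (n + 1)) (t : Fin (n + 2) → unitInterval) (ht : t i.castSucc = 1)
    (p : F.obj x) : F.eval c t p = F.eval (c.compAt i) (i.castSucc.removeNth t) p := by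
  rw [eval_of_nondeg hc, eval_of_nondeg (hc.compAt hC i), F.map_one c i hc (hc.compAt hC i) _ _ ht]
  congr 1
  funext j
  simp only [Fin.removeNth, Fin.init]
  rw [Fin.castSucc_succAbove_castSucc]

variable (F)

/-- Push a point over a labelled path to the end of the longest part of the path that ends with a
label `0`, and remove the labels `1` from the rest of the path. -/
noncomputable def reduce {x : C} (d : LabelledPath C x) (p : F.obj x) :
    Σ y, LabelledPath C y × F.obj y :=
  match d.splitZero with
  | none => ⟨x, d.contract, p⟩
  | some ⟨_, y, a, s, b⟩ => ⟨y, b.contract, F.eval a s p⟩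

variable {F}

theorem reduce_of_none {x : C} {d : LabelledPath C x} (h : d.splitZero = none) (p : F.obj x) :
    F.reduce d p = ⟨x, d.contract, p⟩ := by
  simp only [reduce, h]

theorem reduce_of_some {x : C} {d : LabelledPath C x} {n y a s b}
    (h : d.splitZero = some ⟨n, y, a, s, b⟩) (p : F.obj x) :
    F.reduce d p = ⟨y, b.contract, F.eval a s p⟩ := by
  simp only [reduce, h]

theorem reduce_base {x : C} (d : LabelledPath C x) :
    (F.reduce d (F.base x)).2.2 = F.base (F.reduce d (F.base x)).1 := by
  rcases h : d.splitZero with - | ⟨n, y, a, s, b⟩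
  · rw [reduce_of_none h]
  · rw [reduce_of_some h]
    exact eval_base _ _

/-- Invariance of `reduce` under the identification at a label `0`: that of the labels `0` is used
which is the last one of the whole path. -/
theorem reduce_labelAppend {m : ℕ} {x y : C} (a : Chain C (m + 1) x y)
    (t : Fin (m + 1) → unitInterval) (ht : t (Fin.last m) = 0) (d : LabelledPath C y)
    (p : F.obj x) : F.reduce (a.labelAppend t d) p = F.reduce d (F.eval a t p) := by
  rcases h : d.splitZero with - | ⟨n, z, a', s, b⟩
  · rw [reduce_of_some (Chain.splitZero_labelAppend_of_none a t d ht h), reduce_of_none h]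
  · rw [reduce_of_some (Chain.splitZero_labelAppend_of_some h a t), reduce_of_some h]
    cases n with
    | zero => exact absurd rfl (LabelledPath.ne_zero_of_splitZero h)
    | succ n => rw [eval_append a a' t s ht]

theorem reduce_oneStep (hC : BoundedLength C) {x : C} {d d' : LabelledPath C x} (hd : d.Nondeg)
    (h : d.OneStep d') (p : F.obj x) : F.reduce d p = F.reduce d' p := by
  rcases h.splitZero_cases with ⟨h1, h2⟩ | ⟨n, y, a, s, b, b', h1, h2, h3⟩ |
    ⟨n, y, a, s, b, i, hi, h1, h2⟩
  · rw [reduce_of_none h1, reduce_of_none h2, h.contract_eq]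
  · rw [reduce_of_some h1, reduce_of_some h2, h3.contract_eq]
  · rw [reduce_of_some h1, reduce_of_some h2, eval_compAt hC (hd.of_splitZero h1) i s hi]

end HCDiagram

namespace Hocolim

variable {F}

theorem mk_append {m k : ℕ} {x y z : C} (a : Chain C (m + 1) x y) (b : Chain C k y z)
    (ha : a.Nondeg) (hb : b.Nondeg) (hab : (a.append b).Nondeg)
    (t : Fin (k + (m + 1)) → unitInterval) (p : F.obj x) (ht : t ⟨m, by omega⟩ = 0) :
    mk F (a.append b) hab t p = mk F b hb (fun j => t ⟨m + 1 + j, by omega⟩)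
      (F.map a ha (fun j => t ⟨j, by omega⟩) p) :=
  Quot.sound (HoRel.zero a b ha hb hab t p ht)

theorem mk_compAt {n : ℕ} {x z : C} (c : Chain C (n + 2) x z) (i : Fin (n + 1))
    (hc : c.Nondeg) (hc' : (c.compAt i).Nondeg)
    (t : Fin (n + 2) → unitInterval) (p : F.obj x) (ht : t i.castSucc = 1) :
    mk F c hc t p = mk F (c.compAt i) hc' (i.castSucc.removeNth t) p :=
  Quot.sound (HoRel.one c i hc hc' t p ht)

theorem mk_snoc {n : ℕ} {x y z : C} (c : Chain C n x y) (f : y ⟶ z)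
    (hc : c.Nondeg) (hcf : (c.snoc f).Nondeg)
    (t : Fin (n + 1) → unitInterval) (p : F.obj x) (ht : t (Fin.last n) = 1) :
    mk F (c.snoc f) hcf t p = mk F c hc (Fin.init t) p :=
  Quot.sound (HoRel.last c f hc hcf t p ht)

theorem mk_base {n : ℕ} {x z : C} (c : Chain C n x z) (hc : c.Nondeg)
    (t : Fin n → unitInterval) : mk F c hc t (F.base x) = base F :=
  Quot.sound (HoRel.base c hc t)

theorem mk_congr {n : ℕ} {x z : C} {c c' : Chain C n x z} (h : c = c') (hc : c.Nondeg)
    (hc' : c'.Nondeg) (t : Fin n → unitInterval) (p : F.obj x) :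
    mk F c hc t p = mk F c' hc' t p := by
  subst h
  rfl

theorem continuous_mk {n : ℕ} {x z : C} (c : Chain C n x z) (hc : c.Nondeg) :
    Continuous fun q : (Fin n → unitInterval) × F.obj x => mk F c hc q.1 q.2 :=
  continuous_quot_mk.comp (continuous_inr.comp
    (continuous_sigmaMk (σ := fun s : NSeq C => (Fin s.len → unitInterval) × F.obj s.src)
      (i := ⟨n, x, z, c, hc⟩)))

theorem continuous_of_mk {X : Type*} [TopologicalSpace X] {φ : Hocolim F → X}
    (h : ∀ {n : ℕ} {x z : C} (c : Chain C n x z) (hc : c.Nondeg),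
      Continuous fun q : (Fin n → unitInterval) × F.obj x => φ (mk F c hc q.1 q.2)) :
    Continuous φ := by
  refine isQuotientMap_quot_mk.continuous_iff.2 (continuous_sum_dom.2 ⟨continuous_of_const
    (fun _ _ => rfl), continuous_sigma_iff.2 fun s => h s.chain s.nondeg⟩)

theorem isClosed_of_mk {S : Set (Hocolim F)}
    (h : ∀ {n : ℕ} {x z : C} (c : Chain C n x z) (hc : c.Nondeg),
      IsClosed {q : (Fin n → unitInterval) × F.obj x | mk F c hc q.1 q.2 ∈ S}) : IsClosed S := by
  refine isQuotientMap_quot_mk.isClosed_preimage.1 (isClosed_sum_iff.2 ⟨?_,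
    isClosed_sigma_iff.2 fun s => h s.chain s.nondeg⟩)
  exact isClosed_discrete _

variable (F)

open Classical in
/-- The normal form of a point of the homotopy colimit; the base point has the normal form `none`.
It is computed on representatives by `HCDiagram.reduce`. -/
noncomputable def normalForm (hC : BoundedLength C) :
    Hocolim F → Option (Σ y, LabelledPath C y × F.obj y) :=
  Quot.lift
    (fun q => match q with
      | Sum.inl _ => none
      | Sum.inr ⟨s, t, p⟩ =>
        if (F.reduce (s.chain.label t) p).2.2 = F.base (F.reduce (s.chain.label t) p).1 then none
        else some (F.reduce (s.chain.label t) p))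
    (by
      intro q q' h
      induction h with
      | @zero m k x y z a b ha hb hab t p ht =>
        have e := HCDiagram.reduce_labelAppend a (fun j => t ⟨j, by omega⟩) ht
          (b.label fun j => t ⟨m + 1 + j, by omega⟩) p
        rw [← Chain.label_append, HCDiagram.eval_of_nondeg ha] at e
        simp only [PreHocolim.pt]
        rw [e]
        rfl
      | one c i hc hc' t p ht =>
        simp only [PreHocolim.pt]
        rw [HCDiagram.reduce_oneStep hC (Chain.nondeg_label hc t)
          (Chain.oneStep_label_compAt c i t ht)]
      | last c f hc hcf t p ht =>
        simp only [PreHocolim.pt]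
        rw [HCDiagram.reduce_oneStep hC (Chain.nondeg_label hcf t)
          (Chain.oneStep_label_snoc c f t ht)]
      | base c hc t => exact if_pos (HCDiagram.reduce_base _))

variable {F}

/-- A representative is reduced if none of the identifications shortens it: all of its parameters
lie in the open interval `(0,1)`, and it does not lie over a base point. -/
def IsReduced {n : ℕ} {x : C} (t : Fin n → unitInterval) (p : F.obj x) : Prop :=
  (∀ i, t i ≠ 0) ∧ (∀ i, t i ≠ 1) ∧ p ≠ F.base x

theorem IsReduced.normalForm_mk (hC : BoundedLength C) {n : ℕ} {x z : C} (c : Chain C n x z)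
    (hc : c.Nondeg) {t : Fin n → unitInterval} {p : F.obj x} (h : IsReduced t p) :
    normalForm F hC (mk F c hc t p) = some ⟨x, c.label t, p⟩ := by
  have e : F.reduce (c.label t) p = ⟨x, c.label t, p⟩ := by
    rw [HCDiagram.reduce_of_none (c.splitZero_label_of_forall_ne t h.1),
      c.contract_label_of_forall_ne t h.2.1]
  simp only [normalForm, mk, PreHocolim.pt]
  rw [e, if_neg h.2.2]

theorem IsReduced.mk_ne_base (hC : BoundedLength C) {n : ℕ} {x z : C} (c : Chain C n x z)
    (hc : c.Nondeg) {t : Fin n → unitInterval} {p : F.obj x} (h : IsReduced t p) :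
    mk F c hc t p ≠ base F := by
  intro e
  have := h.normalForm_mk hC c hc
  rw [e] at this
  cases this

/-- Reduced representatives are unique. -/
theorem IsReduced.mk_inj (hC : BoundedLength C) {n n' : ℕ} {x z x' z' : C} {c : Chain C n x z}
    {c' : Chain C n' x' z'} {hc : c.Nondeg} {hc' : c'.Nondeg} {t : Fin n → unitInterval}
    {t' : Fin n' → unitInterval} {p : F.obj x} {p' : F.obj x'} (h : IsReduced t p)
    (h' : IsReduced t' p') (e : mk F c hc t p = mk F c' hc' t' p') :
    n = n' ∧ x = x' ∧ z = z' ∧ HEq c c' ∧ HEq t t' ∧ HEq p p' := by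
  have e1 := h.normalForm_mk hC c hc
  rw [e, h'.normalForm_mk hC c' hc', Option.some.injEq] at e1
  obtain ⟨hx, h2⟩ := Sigma.mk.inj_iff.1 e1
  subst hx
  obtain ⟨h3, h4⟩ := Prod.mk.injEq .. ▸ eq_of_heq h2
  obtain ⟨h5, h6, h7, h8, h9⟩ := Chain.label_injective c t c' t' (by rw [h3])
  exact ⟨h5, h6, h7, h8, h9, heq_of_eq h4.symm⟩

/-- Every point but the base point has a reduced representative: a representative of minimal length
is reduced, since at a parameter `0` or `1` an identification leads to a shorter sequence. -/
theorem eq_base_or_exists_isReduced (hC : BoundedLength C) (q : Hocolim F) :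
    q = base F ∨ ∃ (n : ℕ) (x z : C) (c : Chain C n x z) (hc : c.Nondeg)
      (t : Fin n → unitInterval) (p : F.obj x), IsReduced t p ∧ q = mk F c hc t p := by
  induction q using Hocolim.ind with
  | h0 => exact Or.inl rfl
  | @h n x z c hc t p =>
    induction n using Nat.strong_induction_on generalizing x z with
    | _ n ih =>
    by_cases h0 : ∃ i, t i = 0
    · obtain ⟨i, hi⟩ := h0
      obtain ⟨m, k, y, a, b, rfl, h, hm⟩ := c.exists_eq_append i
      cases h
      have hab := Chain.nondeg_append.1 hc
      rw [mk_append a b hab.1 hab.2 hc t p (by rw [← hi]; congr 1; exact Fin.ext hm.symm)]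
      exact ih k (by omega) _ _ _ _
    by_cases h1 : ∃ i, t i = 1
    · obtain ⟨i, hi⟩ := h1
      cases n with
      | zero => exact i.elim0
      | succ n =>
      induction i using Fin.lastCases with
      | last =>
        obtain ⟨y, a, f, rfl⟩ := c.exists_eq_snoc
        rw [mk_snoc a f (Chain.nondeg_snoc.1 hc).1 hc t p hi]
        exact ih n (by omega) _ _ _ _
      | cast i =>
        cases n with
        | zero => exact i.elim0
        | succ n =>
        rw [mk_compAt c i hc (hc.compAt hC i) t p hi]
        exact ih (n + 1) (by omega) _ _ _ _
    by_cases hp : p = F.base x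
    · subst hp
      exact Or.inl (mk_base c hc t)
    · exact Or.inr ⟨n, x, z, c, hc, t, p, ⟨not_exists.1 h0, not_exists.1 h1, hp⟩, rfl⟩

end Hocolim

end NormalForm

/-! ### Functoriality of the homotopy colimit -/

section Functoriality

variable {C : Type u} [Category.{v} C] {D : Type*} [Category D]

/-- A strict morphism of homotopy coherent diagrams over a functor `Φ` between the index
categories; `Φ` has to preserve non-identity morphisms, since the diagrams are only defined on
sequences of these. -/
structure HCDiagram.Hom (Φ : D ⥤ C) (F' : HCDiagram D) (F : HCDiagram C) where
  isIdentity_of_map : ∀ {x y : D} (f : x ⟶ y), IsIdentity (Φ.map f) → IsIdentity f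
  app : ∀ x, F'.obj x → F.obj (Φ.obj x)
  continuous_app : ∀ x, Continuous (app x)
  app_base : ∀ x, app x (F'.base x) = F.base (Φ.obj x)
  app_map : ∀ {n : ℕ} {x z : D} (c : Chain D (n + 1) x z) (hc : c.Nondeg)
    (t : Fin n → unitInterval) (p : F'.obj x),
    app z (F'.map c hc t p) = F.map (c.map Φ) (hc.map isIdentity_of_map) t (app x p)

namespace Hocolim

variable {Φ : D ⥤ C} {F' : HCDiagram D} {F : HCDiagram C}

/-- The map of homotopy colimits that is induced by a morphism of diagrams. -/
def map (α : HCDiagram.Hom Φ F' F) : Hocolim F' → Hocolim F :=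
  Quot.lift
    (fun q => match q with
      | Sum.inl _ => base F
      | Sum.inr ⟨s, t, p⟩ =>
        mk F (s.chain.map Φ) (s.nondeg.map α.isIdentity_of_map) t (α.app s.src p))
    (by
      intro q q' h
      induction h with
      | zero a b ha hb hab t p ht =>
        have hab' := hab.map α.isIdentity_of_map
        rw [Chain.map_append] at hab'
        refine (mk_congr (Chain.map_append Φ a b) _ hab' t _).trans ?_
        refine (mk_append _ _ (ha.map α.isIdentity_of_map) (hb.map α.isIdentity_of_map) _ t _
          ht).trans ?_
        rw [← α.app_map a ha]
        rfl
      | one c i hc hc' t p ht =>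
        have hc'' := hc'.map α.isIdentity_of_map
        rw [Chain.map_compAt] at hc''
        refine (mk_compAt _ i _ hc'' t _ ht).trans ?_
        exact mk_congr (Chain.map_compAt Φ c i).symm _ _ _ _
      | last c f hc hcf t p ht =>
        have hcf' := hcf.map α.isIdentity_of_map
        rw [Chain.map_snoc] at hcf'
        refine (mk_congr (Chain.map_snoc Φ c f) _ hcf' t _).trans ?_
        exact mk_snoc _ _ _ hcf' t _ ht
      | base c hc t =>
        simp only [PreHocolim.pt, α.app_base]
        exact mk_base _ _ t)

theorem continuous_map (α : HCDiagram.Hom Φ F' F) : Continuous (map α) :=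
  continuous_of_mk fun c hc => (continuous_mk (c.map Φ) (hc.map α.isIdentity_of_map)).comp
    (continuous_fst.prodMk ((α.continuous_app _).comp continuous_snd))

end Hocolim

theorem KStructure.continuous_hocolimMap {K : Type*} [Group K] {F : HCDiagram.{u, v, w} C}
    (κ : KStructure K F) (k : K) : Continuous (κ.hocolimMap k) :=
  Hocolim.continuous_of_mk fun c hc => (Hocolim.continuous_mk c hc).comp
    (continuous_fst.prodMk ((κ.continuous_smul k _).comp continuous_snd))

end Functoriality

/-! ### The actions of `G` and of `K × G` -/

section Action

variable {G : Type*} [Group G] {C : Type u} [Category.{v} C] {ψ : CategoryAction G C}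
  {F : HCDiagram.{u, v, w} C}

/-- Equal functors give equal points.  The points over the sources are compared in the total
space, since the two sources are not definitionally equal. -/
theorem Hocolim.mk_map_congr {Φ Φ' : C ⥤ C} (e : Φ = Φ') {n : ℕ} {x z : C} (c : Chain C n x z)
    (hc : (c.map Φ).Nondeg) (hc' : (c.map Φ').Nondeg) (t : Fin n → unitInterval)
    {p : F.obj (Φ.obj x)} {p' : F.obj (Φ'.obj x)}
    (hp : (⟨_, p⟩ : Σ x, F.obj x) = ⟨_, p'⟩) :
    Hocolim.mk F (c.map Φ) hc t p = Hocolim.mk F (c.map Φ') hc' t p' := by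
  subst e
  rw [eq_of_heq (Sigma.mk.inj_iff.1 hp).2]

namespace ExternalAction

/-- The action of `g` as a morphism of diagrams over the functor `ψ g`. -/
def hom (E : ExternalAction ψ F) (g : G) : HCDiagram.Hom (ψ.functor g) F F where
  isIdentity_of_map _ := ψ.isIdentity_of_map g
  app := E.map g
  continuous_app := E.continuous_map g
  app_base := E.map_base g
  app_map := E.map_map g

/-- The inclusion of the restricted diagram `F^H`. -/
def inclHom (E : ExternalAction ψ F) (H : Subgroup G) :
    HCDiagram.Hom (FixedCat.incl ψ H) (E.fixedDiagram H) F where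
  isIdentity_of_map := FixedCat.isIdentity_of_incl
  app _ p := p.1
  continuous_app _ := continuous_subtype_val
  app_base _ := rfl
  app_map _ _ _ _ := rfl

/-- The action of `G` on the homotopy colimit. -/
@[reducible] def hocolimAction (E : ExternalAction ψ F) : MulAction G (Hocolim F) where
  smul g := Hocolim.map (E.hom g)
  one_smul q := by
    induction q using Hocolim.ind with
    | h0 => rfl
    | h c hc t p =>
      have hc' : (c.map (𝟭 C)).Nondeg := by rwa [Chain.map_id]
      exact (Hocolim.mk_map_congr ψ.functor_one c _ hc' t (E.map_one _ p)).trans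
        (Hocolim.mk_congr (Chain.map_id c) hc' hc t p)
  mul_smul g h q := by
    induction q using Hocolim.ind with
    | h0 => rfl
    | h c hc t p =>
      have e := Chain.map_comp (ψ.functor h) (ψ.functor g) c
      have hc' : (c.map (ψ.functor h ⋙ ψ.functor g)).Nondeg := by
        rw [e]
        exact (hc.act ψ h).act ψ g
      exact (Hocolim.mk_map_congr (ψ.functor_mul g h) c _ hc' t (E.map_mul g h _ p)).trans
        (Hocolim.mk_congr e hc' ((hc.act ψ h).act ψ g) t _)

theorem hocolimMap_map (E : ExternalAction ψ F) {K : Type*} [Group K] {κ : KStructure K F}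
    (hκ : E.Commutes κ) (g : G) (k : K) (q : Hocolim F) :
    Hocolim.map (E.hom g) (κ.hocolimMap k q) = κ.hocolimMap k (Hocolim.map (E.hom g) q) := by
  induction q using Hocolim.ind with
  | h0 => rfl
  | h c hc t p => exact congrArg (Hocolim.mk F _ (hc.act ψ g) t) (hκ g k _ p)

/-- The action of `K × G` on the homotopy colimit. -/
@[reducible] def hocolimProdAction (E : ExternalAction ψ F) {K : Type*} [Group K]
    {κ : KStructure K F} (hκ : E.Commutes κ) : MulAction (K × G) (Hocolim F) where
  smul kg q := Hocolim.map (E.hom kg.2) (κ.hocolimMap kg.1 q)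
  one_smul q := (E.hocolimAction.one_smul _).trans (κ.hocolimAction.one_smul q)
  mul_smul a b q := by
    change Hocolim.map (E.hom (a.2 * b.2)) (κ.hocolimMap (a.1 * b.1) q) =
      Hocolim.map (E.hom a.2) (κ.hocolimMap a.1 (Hocolim.map (E.hom b.2) (κ.hocolimMap b.1 q)))
    rw [← E.hocolimMap_map hκ]
    exact (E.hocolimAction.mul_smul _ _ _).trans (congrArg
      (fun r => Hocolim.map (E.hom a.2) (Hocolim.map (E.hom b.2) r))
      (κ.hocolimAction.mul_smul a.1 b.1 q))

end ExternalAction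

end Action

/-! ### The fixed points of a subgroup -/

section FixedPoints

variable {G : Type*} [Group G] {C : Type u} [Category.{v} C] {ψ : CategoryAction G C}
  {F : HCDiagram.{u, v, w} C} {H : Subgroup G}

theorem BoundedLength.fixedCat (hC : BoundedLength C) (ψ : CategoryAction G C) (H : Subgroup G) :
    BoundedLength (FixedCat ψ H) := by
  obtain ⟨N, hN⟩ := hC
  exact ⟨N, fun n x z c hc => hN n _ _ _ hc.incl⟩

theorem FixedCat.ext_obj {x y : FixedCat ψ H} (h : x.obj = y.obj) : x = y := by
  cases x
  cases y
  cases h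
  rfl

theorem FixedCat.chain_map_incl_inj {n : ℕ} {x z : FixedCat ψ H} (c : Chain (FixedCat ψ H) n x z) :
    ∀ {x' z' : FixedCat ψ H} (c' : Chain (FixedCat ψ H) n x' z'), x.obj = x'.obj →
    z.obj = z'.obj → HEq (c.map (FixedCat.incl ψ H)) (c'.map (FixedCat.incl ψ H)) →
    x = x' ∧ z = z' ∧ HEq c c' := by
  induction c with
  | nil x =>
    intro x' z' c' hx hz h
    cases c'
    obtain rfl := FixedCat.ext_obj hx
    exact ⟨rfl, rfl, HEq.rfl⟩
  | @cons n x y z f c ih =>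
    intro x' z' c' hx hz h
    cases c' with
    | @cons _ _ y' _ f' c' =>
    obtain rfl := FixedCat.ext_obj hx
    obtain rfl := FixedCat.ext_obj hz
    obtain ⟨hy, hf, hc⟩ := Chain.cons.inj (eq_of_heq h)
    obtain ⟨rfl, -, hc⟩ := ih c' hy rfl hc
    cases hc
    obtain rfl : f = f' := Subtype.ext (eq_of_heq hf)
    exact ⟨rfl, rfl, HEq.rfl⟩

/-- A sequence that is fixed by `H` lies in `C^H`. -/
theorem FixedCat.exists_chain {n : ℕ} {x z : C} (c : Chain C n x z) (hc : c.Nondeg)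
    (hx : ∀ h ∈ H, (ψ.functor h).obj x = x) (hz : ∀ h ∈ H, (ψ.functor h).obj z = z)
    (h : ∀ h ∈ H, HEq (c.map (ψ.functor h)) c) :
    ∃ (x' z' : FixedCat ψ H) (c' : Chain (FixedCat ψ H) n x' z'), c'.Nondeg ∧ x'.obj = x ∧
      z'.obj = z ∧ HEq (c'.map (FixedCat.incl ψ H)) c := by
  induction c with
  | nil x => exact ⟨⟨x, hx⟩, ⟨x, hx⟩, .nil _, trivial, rfl, rfl, HEq.rfl⟩
  | @cons n x y z f c ih =>
    have key : ∀ {x y z x' y' z' : C} {f : x ⟶ y} {f' : x' ⟶ y'} {c : Chain C n y z}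
        {c' : Chain C n y' z'}, x = x' → z = z' → HEq (Chain.cons f c) (Chain.cons f' c') →
        y = y' ∧ HEq f f' ∧ HEq c c' := by
      rintro x y z x' y' z' f f' c c' rfl rfl h
      cases h
      exact ⟨rfl, HEq.rfl, HEq.rfl⟩
    have h' := fun g hg => key (hx g hg) (hz g hg) (h g hg)
    obtain ⟨y', z', c', hc', rfl, rfl, e⟩ := ih hc.2 (fun g hg => (h' g hg).1) hz
      fun g hg => (h' g hg).2.2
    cases e
    let f' : (⟨x, hx⟩ : FixedCat ψ H) ⟶ y' := ⟨f, fun g hg => (h' g hg).2.1⟩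
    exact ⟨⟨x, hx⟩, z', .cons f' c', ⟨fun hf => hc.1 (hf.map (FixedCat.incl ψ H)), hc'⟩,
      rfl, rfl, HEq.rfl⟩

namespace Hocolim

variable (E : ExternalAction ψ F)

theorem IsReduced.incl {n : ℕ} {x : FixedCat ψ H} {t : Fin n → unitInterval}
    {p : (E.fixedDiagram H).obj x} (h : IsReduced t p) :
    IsReduced (F := F) (x := x.obj) t p.1 :=
  ⟨h.1, h.2.1, fun e => h.2.2 (Subtype.ext e)⟩

/-- The inclusion maps reduced representatives to reduced ones, and these are unique. -/
theorem map_inclHom_injective (hC : BoundedLength C) :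
    Function.Injective (map (E.inclHom H)) := by
  intro q q' e
  rcases eq_base_or_exists_isReduced (hC.fixedCat ψ H) q with
    rfl | ⟨n, x, z, c, hc, t, p, h, rfl⟩ <;>
  rcases eq_base_or_exists_isReduced (hC.fixedCat ψ H) q' with
    rfl | ⟨n', x', z', c', hc', t', p', h', rfl⟩
  · rfl
  · exact absurd e.symm ((h'.incl E).mk_ne_base hC _ _)
  · exact absurd e ((h.incl E).mk_ne_base hC _ _)
  · obtain ⟨rfl, hx, hz, hcc, ht, hp⟩ := IsReduced.mk_inj hC (h.incl E) (h'.incl E) e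
    obtain ⟨rfl, rfl, hcc⟩ := FixedCat.chain_map_incl_inj c c' hx hz hcc
    cases hcc
    cases ht
    obtain rfl : p = p' := Subtype.ext (eq_of_heq hp)
    rfl

theorem map_hom_map_inclHom {h : G} (hh : h ∈ H) (q : Hocolim (E.fixedDiagram H)) :
    map (E.hom h) (map (E.inclHom H) q) = map (E.inclHom H) q := by
  induction q using Hocolim.ind with
  | h0 => rfl
  | @h n x z c hc t p =>
    have key : ∀ {x z x' z' : C} (_ : x = x') (_ : z = z') {c : Chain C n x z}
        {c' : Chain C n x' z'} (hc : c.Nondeg) (hc' : c'.Nondeg) {p : F.obj x} {p' : F.obj x'},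
        HEq c c' → (⟨x, p⟩ : Σ x, F.obj x) = ⟨x', p'⟩ → mk F c hc t p = mk F c' hc' t p' := by
      rintro x z _ _ rfl rfl c c' hc hc' p p' h hp
      cases h
      rw [eq_of_heq (Sigma.mk.inj_iff.1 hp).2]
    exact key (x.fixed h hh) (z.fixed h hh) _ _ (FixedCat.chain_invariant hh c) (p.2 h hh)

theorem range_map_inclHom (hC : BoundedLength C) :
    Set.range (map (E.inclHom H)) = {q | ∀ h ∈ H, map (E.hom h) q = q} := by
  refine Set.Subset.antisymm ?_ fun q hq => ?_
  · rintro _ ⟨q, rfl⟩ h hh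
    exact map_hom_map_inclHom E hh q
  rcases eq_base_or_exists_isReduced hC q with rfl | ⟨n, x, z, c, hc, t, p, h, rfl⟩
  · exact ⟨base _, rfl⟩
  -- The translates of a reduced representative are reduced, so they all agree with it.
  have key : ∀ g ∈ H, (ψ.functor g).obj x = x ∧ (ψ.functor g).obj z = z ∧
      HEq (c.map (ψ.functor g)) c ∧ HEq (E.map g x p) p := by
    intro g hg
    have hr : IsReduced t (E.map g x p) := by
      refine ⟨h.1, h.2.1, fun e => h.2.2 ?_⟩
      -- `g⁻¹` takes the base point to a base point, so `p` would be one.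
      have e1 := E.map_mul g⁻¹ g x p
      rw [e, E.map_base, inv_mul_cancel, E.map_one] at e1
      have key : ∀ {y : C}, (⟨x, p⟩ : Σ x, F.obj x) = ⟨y, F.base y⟩ → p = F.base x := by
        rintro y ⟨⟩
        rfl
      exact key e1
    obtain ⟨-, hx, hz, hcc, -, hp⟩ := IsReduced.mk_inj hC hr h (hq g hg)
    exact ⟨hx, hz, hcc, hp⟩
  obtain ⟨x', z', c', hc', rfl, rfl, e⟩ := FixedCat.exists_chain c hc (fun g hg => (key g hg).1)
    (fun g hg => (key g hg).2.1) fun g hg => (key g hg).2.2.1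
  cases e
  exact ⟨mk (E.fixedDiagram H) c' hc' t
    ⟨p, fun g hg => Sigma.mk.inj_iff.2 ⟨(key g hg).1, (key g hg).2.2.2⟩⟩, rfl⟩

theorem isClosed_fixedPts [∀ x, T2Space (F.obj x)] (x : FixedCat ψ H) :
    IsClosed {p : F.obj x.obj | ∀ h ∈ H, (⟨_, E.map h x.obj p⟩ : Σ c, F.obj c) = ⟨x.obj, p⟩} := by
  have key : ∀ {y : C} (_ : y = x.obj) (φ : F.obj x.obj → F.obj y), Continuous φ →
      IsClosed {p : F.obj x.obj | (⟨y, φ p⟩ : Σ c, F.obj c) = ⟨x.obj, p⟩} := by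
    rintro _ rfl φ hφ
    simp only [Sigma.mk.inj_iff, heq_eq_eq, true_and]
    exact isClosed_eq hφ continuous_id
  simp only [Set.ofPred_forall]
  exact isClosed_iInter fun h => isClosed_iInter fun hh =>
    key (x.fixed h hh) _ (E.continuous_map h x.obj)

/-- The image of a closed set `A` is closed, on the cell of each sequence `c`, by induction on the
length of `c`.  On the faces of the cube the identifications lead to shorter sequences, and over
the base point there is only the base point of the homotopy colimit.  All other points of the cell
are reduced, so that they are in the image only if they are fixed by `H`, and there the image is
that of a closed set under the closed embedding of the fixed points. -/
theorem isClosed_preimage_mk_image [∀ x, T2Space (F.obj x)] (hC : BoundedLength C)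
    {A : Set (Hocolim (E.fixedDiagram H))} (hA : IsClosed A) {n : ℕ} {x z : C} (c : Chain C n x z)
    (hc : c.Nondeg) :
    IsClosed {q : (Fin n → unitInterval) × F.obj x |
      mk F c hc q.1 q.2 ∈ map (E.inclHom H) '' A} := by
  induction n using Nat.strong_induction_on generalizing x z with
  | _ n ih =>
  set S := {q : (Fin n → unitInterval) × F.obj x | mk F c hc q.1 q.2 ∈ map (E.inclHom H) '' A}
    with hS
  have coord (i : Fin n) (r : unitInterval) :
      IsClosed {q : (Fin n → unitInterval) × F.obj x | q.1 i = r} :=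
    isClosed_eq ((continuous_apply i).comp continuous_fst) continuous_const
  have zero (i : Fin n) : IsClosed (S ∩ {q | q.1 i = 0}) := by
    obtain ⟨m, k, y, a, b, rfl, h, hm⟩ := c.exists_eq_append i
    cases h
    rw [show i = ⟨m, by omega⟩ from Fin.ext hm]
    have hab := Chain.nondeg_append.1 hc
    have h1 : Continuous fun q : (Fin (k + (m + 1)) → unitInterval) × F.obj x =>
        ((fun j : Fin k => q.1 ⟨m + 1 + j, by omega⟩,
          F.map a hab.1 (fun j => q.1 ⟨j, by omega⟩) q.2) : (Fin k → unitInterval) × F.obj y) := by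
      refine Continuous.prodMk (by fun_prop) ?_
      exact (F.continuous_map a hab.1).comp (Continuous.prodMk (by fun_prop) continuous_snd)
    convert ((ih k (by omega) b hab.2).preimage h1).inter (coord ⟨m, by omega⟩ 0) using 1
    ext q
    refine and_congr_left fun hq => ?_
    rw [hS, Set.mem_ofPred_eq, mk_append a b hab.1 hab.2 hc q.1 q.2 hq]
    rfl
  have one (i : Fin n) : IsClosed (S ∩ {q | q.1 i = 1}) := by
    cases n with
    | zero => exact i.elim0
    | succ n =>
    induction i using Fin.lastCases with
    | last =>
      obtain ⟨y, a, f, rfl⟩ := c.exists_eq_snoc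
      have ha := (Chain.nondeg_snoc.1 hc).1
      have h1 : Continuous fun q : (Fin (n + 1) → unitInterval) × F.obj x =>
          ((Fin.init q.1, q.2) : (Fin n → unitInterval) × F.obj x) :=
        Continuous.prodMk (continuous_pi fun j =>
          (continuous_apply j.castSucc).comp continuous_fst) continuous_snd
      convert ((ih n (by omega) a ha).preimage h1).inter (coord (Fin.last n) 1) using 1
      ext q
      refine and_congr_left fun hq => ?_
      rw [hS, Set.mem_ofPred_eq, mk_snoc a f ha hc q.1 q.2 hq]
      rfl
    | cast i =>
      cases n with
      | zero => exact i.elim0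
      | succ n =>
      have hc' := hc.compAt hC i
      have h1 : Continuous fun q : (Fin (n + 2) → unitInterval) × F.obj x =>
          ((i.castSucc.removeNth q.1, q.2) : (Fin (n + 1) → unitInterval) × F.obj x) :=
        Continuous.prodMk (continuous_pi fun j =>
          (continuous_apply (i.castSucc.succAbove j)).comp continuous_fst) continuous_snd
      convert ((ih (n + 1) (by omega) (c.compAt i) hc').preimage h1).inter (coord i.castSucc 1)
        using 1
      ext q
      refine and_congr_left fun hq => ?_
      rw [hS, Set.mem_ofPred_eq, mk_compAt c i hc hc' q.1 q.2 hq]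
      rfl
  have base_closed : IsClosed (S ∩ {q | q.2 = F.base x}) := by
    by_cases hb : base F ∈ map (E.inclHom H) '' A
    · convert isClosed_eq (continuous_snd (X := Fin n → unitInterval) (Y := F.obj x))
        (continuous_const (y := F.base x)) using 1
      refine Set.inter_eq_right.2 fun q hq => ?_
      rw [hS, Set.mem_ofPred_eq, show q.2 = F.base x from hq, mk_base]
      exact hb
    · convert isClosed_empty using 1
      refine Set.eq_empty_iff_forall_notMem.2 fun q hq => hb ?_
      have := hq.1
      rwa [hS, Set.mem_ofPred_eq, show q.2 = F.base x from hq.2, mk_base] at this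
  -- `J` consists of the points that lie in the image of `A` cell by cell.
  obtain ⟨J, hJ, hJS, hSJ⟩ : ∃ J : Set ((Fin n → unitInterval) × F.obj x), IsClosed J ∧ J ⊆ S ∧
      ∀ q ∈ S, IsReduced q.1 q.2 → q ∈ J := by
    by_cases hl : ∃ (x' z' : FixedCat ψ H) (c' : Chain (FixedCat ψ H) n x' z'), c'.Nondeg ∧
        x'.obj = x ∧ z'.obj = z ∧ HEq (c'.map (FixedCat.incl ψ H)) c
    · obtain ⟨x', z', c', hc', rfl, rfl, e⟩ := hl
      cases e
      -- This is where the Hausdorff property enters.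
      have hι : Topology.IsClosedEmbedding
          (Prod.map id Subtype.val : (Fin n → unitInterval) × E.FixedPts x' →
            (Fin n → unitInterval) × F.obj x'.obj) :=
        Topology.IsClosedEmbedding.id.prodMap (isClosed_fixedPts E x').isClosedEmbedding_subtypeVal
      refine ⟨_, hι.isClosedMap _ (hA.preimage (continuous_mk (F := E.fixedDiagram H) c' hc')),
        ?_, ?_⟩
      · rintro _ ⟨q, hq, rfl⟩
        exact ⟨_, hq, rfl⟩
      · rintro ⟨t, p⟩ ⟨q, hq, e⟩ hr
        rcases eq_base_or_exists_isReduced (hC.fixedCat ψ H) q with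
          rfl | ⟨n', x'', z'', c'', hc'', t', p', h', rfl⟩
        · exact absurd e.symm (hr.mk_ne_base hC _ _)
        obtain ⟨rfl, hx, hz, hcc, ht, hp⟩ := IsReduced.mk_inj hC (h'.incl E) hr e
        obtain ⟨rfl, rfl, hcc⟩ := FixedCat.chain_map_incl_inj c'' c' hx hz hcc
        cases hcc
        cases ht
        cases hp
        exact ⟨(t, p'), hq, rfl⟩
    · refine ⟨∅, isClosed_empty, Set.empty_subset _, ?_⟩
      rintro ⟨t, p⟩ ⟨q, hq, e⟩ hr
      rcases eq_base_or_exists_isReduced (hC.fixedCat ψ H) q with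
        rfl | ⟨n', x', z', c', hc', t', p', h', rfl⟩
      · exact absurd e.symm (hr.mk_ne_base hC _ _)
      obtain ⟨rfl, hx, hz, hcc, -, -⟩ := IsReduced.mk_inj hC (h'.incl E) hr e
      exact hl ⟨x', z', c', hc', hx, hz, hcc⟩
  have hU : S = (((⋃ i, S ∩ {q | q.1 i = 0}) ∪ ⋃ i, S ∩ {q | q.1 i = 1}) ∪
      (S ∩ {q | q.2 = F.base x})) ∪ J := by
    ext q
    refine ⟨fun hq => ?_, ?_⟩
    · by_cases h0 : ∃ i, q.1 i = 0
      · exact Or.inl (Or.inl (Or.inl (Set.mem_iUnion.2 (h0.imp fun i hi => ⟨hq, hi⟩))))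
      by_cases h1 : ∃ i, q.1 i = 1
      · exact Or.inl (Or.inl (Or.inr (Set.mem_iUnion.2 (h1.imp fun i hi => ⟨hq, hi⟩))))
      by_cases hp : q.2 = F.base x
      · exact Or.inl (Or.inr ⟨hq, hp⟩)
      · exact Or.inr (hSJ q hq ⟨not_exists.1 h0, not_exists.1 h1, hp⟩)
    · rintro (((h | h) | h) | h)
      · exact (Set.mem_iUnion.1 h).choose_spec.1
      · exact (Set.mem_iUnion.1 h).choose_spec.1
      · exact h.1
      · exact hJS h
  rw [hU]
  exact (((isClosed_iUnion_of_finite zero).union (isClosed_iUnion_of_finite one)).union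
    base_closed).union hJ

theorem isClosedEmbedding_map_inclHom [∀ x, T2Space (F.obj x)] (hC : BoundedLength C) :
    Topology.IsClosedEmbedding (map (E.inclHom H)) :=
  .of_continuous_injective_isClosedMap (continuous_map _) (map_inclHom_injective E hC)
    fun _ hA => isClosed_of_mk fun c hc => isClosed_preimage_mk_image E hC hA c hc

theorem exists_homeomorph_fixedPoints [∀ x, T2Space (F.obj x)] (hC : BoundedLength C)
    {P : Hocolim F → Prop} (hP : ∀ q, P q ↔ ∀ h ∈ H, map (E.hom h) q = q) :
    ∃ e : Hocolim (E.fixedDiagram H) ≃ₜ {q // P q}, ∀ q, (e q).1 = map (E.inclHom H) q :=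
  ⟨(isClosedEmbedding_map_inclHom E hC).isEmbedding.toHomeomorph.trans
    (Homeomorph.setCongr ((range_map_inclHom E hC).trans
      (Set.ext fun q => (hP q).symm) : _ = {q | P q})), fun _ => rfl⟩

end Hocolim

end FixedPoints

theorem proposition5p2 {C : Type u} [Category.{v} C] (hC : BoundedLength C)
    {G : Type*} [Group G] [Finite G] (ψ : CategoryAction G C)
    (F : HCDiagram.{u, v, w} C) (E : ExternalAction ψ F) :
    -- diagrams in `Top_*`
    (∃ A : MulAction G (Hocolim F),
      (∀ g : G, Continuous fun q : Hocolim F => A.smul g q) ∧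
      (∀ g : G, A.smul g (Hocolim.base F) = Hocolim.base F) ∧
      (∀ (g : G) {n : ℕ} {x z : C} (c : Chain C n x z) (hc : c.Nondeg)
        (t : Fin n → unitInterval) (y : F.obj x),
        A.smul g (Hocolim.mk F c hc t y) =
          Hocolim.mk F (c.map (ψ.functor g)) (hc.act ψ g) t (E.map g x y)) ∧
      ((∀ x : C, T2Space (F.obj x)) → ∀ H : Subgroup G,
        ∃ e : Hocolim (E.fixedDiagram H) ≃ₜ {q : Hocolim F // ∀ h ∈ H, A.smul h q = q},
          (e (Hocolim.base (E.fixedDiagram H))).1 = Hocolim.base F ∧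
          ∀ {n : ℕ} {x z : FixedCat ψ H} (c : Chain (FixedCat ψ H) n x z) (hc : c.Nondeg)
            (t : Fin n → unitInterval) (y : (E.fixedDiagram H).obj x),
            (e (Hocolim.mk (E.fixedDiagram H) c hc t y)).1 =
              Hocolim.mk F (c.map (FixedCat.incl ψ H)) hc.incl t y.1)) ∧
    -- diagrams in `K`-`Top_*`
    (∀ {K : Type*} [Group K] (κ : KStructure K F) (hκ : E.Commutes κ),
      ∃ B : MulAction (K × G) (Hocolim F),
        (∀ kg : K × G, Continuous fun q : Hocolim F => B.smul kg q) ∧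
        (∀ kg : K × G, B.smul kg (Hocolim.base F) = Hocolim.base F) ∧
        (∀ (k : K) (q : Hocolim F), B.smul (k, 1) q = κ.hocolimAction.smul k q) ∧
        (∀ (k : K) (g : G) {n : ℕ} {x z : C} (c : Chain C n x z) (hc : c.Nondeg)
          (t : Fin n → unitInterval) (y : F.obj x),
          B.smul (k, g) (Hocolim.mk F c hc t y) =
            Hocolim.mk F (c.map (ψ.functor g)) (hc.act ψ g) t
              (E.map g x ((κ.act x).smul k y))) ∧
        ((∀ x : C, T2Space (F.obj x)) → ∀ H : Subgroup G,
          ∃ e : Hocolim (E.fixedDiagram H) ≃ₜ {q : Hocolim F // ∀ h ∈ H, B.smul (1, h) q = q},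
            (e (Hocolim.base (E.fixedDiagram H))).1 = Hocolim.base F ∧
            (∀ {n : ℕ} {x z : FixedCat ψ H} (c : Chain (FixedCat ψ H) n x z) (hc : c.Nondeg)
              (t : Fin n → unitInterval) (y : (E.fixedDiagram H).obj x),
              (e (Hocolim.mk (E.fixedDiagram H) c hc t y)).1 =
                Hocolim.mk F (c.map (FixedCat.incl ψ H)) hc.incl t y.1) ∧
            (∀ (k : K) (q : Hocolim (E.fixedDiagram H)),
              (e ((κ.fixed E hκ H).hocolimAction.smul k q)).1 = B.smul (k, 1) (e q).1))) := by
  refine ⟨⟨E.hocolimAction, fun g => Hocolim.continuous_map _, fun _ => rfl,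
    fun _ _ _ _ _ _ _ _ => rfl, fun hT H => ?_⟩, fun {K} _ κ hκ =>
    ⟨E.hocolimProdAction hκ, fun kg => (Hocolim.continuous_map _).comp
      (κ.continuous_hocolimMap kg.1), fun _ => rfl,
      fun k q => E.hocolimAction.one_smul _, fun _ _ _ _ _ _ _ _ _ => rfl, fun hT H => ?_⟩⟩
  · obtain ⟨e, he⟩ := Hocolim.exists_homeomorph_fixedPoints E (H := H) hC
      (P := fun q => ∀ h ∈ H, E.hocolimAction.smul h q = q) fun q => Iff.rfl
    exact ⟨e, he _, fun _ _ _ _ => he _⟩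
  · have h1 (h : G) (q : Hocolim F) :
        (E.hocolimProdAction hκ).smul (1, h) q = Hocolim.map (E.hom h) q :=
      congrArg (Hocolim.map (E.hom h)) (κ.hocolimAction.one_smul q)
    obtain ⟨e, he⟩ := Hocolim.exists_homeomorph_fixedPoints E (H := H) hC
      (P := fun q => ∀ h ∈ H, (E.hocolimProdAction hκ).smul (1, h) q = q) fun q => by
        simp only [h1]
    refine ⟨e, he _, fun _ _ _ _ => he _, fun k q => ?_⟩
    rw [he, he]
    refine Eq.trans ?_ (E.hocolimAction.one_smul _).symm
    induction q using Hocolim.ind with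
    | h0 => rfl
    | h c hc t p => rfl
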